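/- Let $\mathcal G\rightrightarrows X$ be a proper, locally compact Hausdorff topological groupoid with source $s$ and range $r$ (proper: $(s,r):\mathcal G\to X\times X$ is a proper map) which admits a left Haar system. For $n\ge 0$ let $\mathcal G_n=\operatorname{Hom}([n]\times[n],\mathcal G)$ be the space of strict morphisms from the pair groupoid on $[n]=\{0,\dots,n\}$ to $\mathcal G$, i.e. $\mathcal G_0=X$ and, for $n\ge1$, the space of composable $n$-tuples $(g_1,\dots,g_n)$. Assume that every $\mathcal G_n$ and the orbit space $X/\mathcal G$ are paracompact. Let $E\to X$ be a real $\mathcal G$-equivariant vector bundle of rank $p$, i.e. a locally trivial real vector bundle with a continuous left action of $\mathcal G$ by linear maps $E_{s(g)}\to E_{r(g)}$, and let $E^\bullet$ be the associated sheaf on the simplicial space $\mathcal G_\bullet$: $E^n$ is the sheaf of continuous sections of the bundle over $\mathcal G_n$ with fibre $E_{s(g_n)}$ over $(g_1,\dots,g_n)$ (and $E_x$ over $x\in X$ if $n=0$), and the action of $\mathcal G$ provides the restriction maps $\tilde f^*$ for $f:[m]\to[n]$. Then $$\check H^n(\mathcal G_\bullet,E^\bullet)=0\qquad\text{for all } n\ge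 1 .$$ Here $\check H^n$ is the following Čech cohomology. An open cover $\mathcal U_\bullet$ of $\mathcal G_\bullet$ is a sequence of open covers $\mathcal U_k=(U^k_j)_{j\in J_k}$ of the spaces $\mathcal G_k$. Let $\Lambda_n$ be the set of families $\lambda=(\lambda(f))$ with $\lambda(f)\in J_k$ for every increasing map $f:[k]\to[n]$, and put $U^n_\lambda=\bigcap_f\tilde f^{-1}(U^k_{\lambda(f)})$ and $(\tilde f\lambda)(g)=\lambda(f\circ g)$. Then $H^n(\mathcal U_\bullet,E^\bullet)$ is the cohomology of the complex $C^n=\prod_{\lambda\in\Lambda_n}E^n(U^n_\lambda)$ with $(dc)_\lambda=\sum_{k=0}^{n+1}(-1)^k\tilde\varepsilon_k^*(c_{\tilde\varepsilon_k\lambda})$, where $\varepsilon_k:[n]\to[n+1]$ is the increasing map that omits $k$. Finally, $\check H^n(\mathcal G_\bullet,E^\bullet)$ is the direct limit under refinement of the groups $H^n(\mathcal U_\bullet,E^\bullet)$ over those open covers whose $N$-skeleton admits an $N$-simplicial structure for some $N\ge n+1$ (compatible maps $\tilde f:J_n\to J_m$ with $\tilde f(U^n_j)\subseteq U^m_{\tilde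 f(j)}$ for all nondecreasing $f:[m]\to[n]$ with $m,n\le N$). -/

import Mathlib

open Bundle CategoryTheory MeasureTheory Topology

universe u v w

set_option linter.unusedSectionVars false

noncomputable section

namespace GroupoidCech

/-! ## Topological groupoids

A groupoid with unit space `X` is Mathlib's `Groupoid X`.  An arrow `g : x ⟶ y` has source
`s(g) = x` and range `r(g) = y`; the groupoid product `g h` (defined when `s(g) = r(h)`) is the
composite `h ≫ g`. -/

/-- The space `𝒢` of all arrows of a groupoid. -/
@[ext]
structure Arr (X : Type u) [Groupoid.{v} X] : Type (max u v) where
  {src : X}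
  {tgt : X}
  hom : src ⟶ tgt

/-- The set of composable pairs of arrows. -/
structure ComposablePair (X : Type u) [Groupoid.{v} X] : Type (max u v) where
  {x : X}
  {y : X}
  {z : X}
  fst : x ⟶ y
  snd : y ⟶ z

section Top

variable (X : Type u) [Groupoid.{v} X]

/-- The fibre product topology, i.e. the topology induced from `𝒢 × 𝒢`. -/
instance [TopologicalSpace (Arr X)] : TopologicalSpace (ComposablePair X) :=
  TopologicalSpace.induced (fun p => (Arr.mk p.fst, Arr.mk p.snd)) inferInstance

/-- A topological groupoid: all the structure maps are continuous. -/
class TopologicalGroupoid [TopologicalSpace X] [TopologicalSpace (Arr X)] : Prop where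
  continuous_src : Continuous (fun g : Arr X => g.src)
  continuous_tgt : Continuous (fun g : Arr X => g.tgt)
  continuous_unit : Continuous (fun x : X => Arr.mk (𝟙 x))
  continuous_inv : Continuous (fun g : Arr X => Arr.mk (Groupoid.inv g.hom))
  continuous_comp : Continuous (fun p : ComposablePair X => Arr.mk (p.fst ≫ p.snd))

/-- A proper groupoid: the map `(s, r) : 𝒢 → X × X` is proper. -/
def IsProperGroupoid [TopologicalSpace X] [TopologicalSpace (Arr X)] : Prop :=
  IsProperMap (fun g : Arr X => (g.src, g.tgt))

/-- The orbit space `X / 𝒢` (with the quotient topology): two points are identified when there is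
an arrow between them. -/
abbrev OrbitSpace : Type u := Quotient (isIsomorphicSetoid X)

variable {X}

/-- The range fibre `𝒢ˣ = {h ∈ 𝒢 | r(h) = x}`. -/
abbrev RangeFibre (x : X) : Type (max u v) := {h : Arr X // h.tgt = x}

/-- Left multiplication `h ↦ g h` by `g`, a map `𝒢^{s(g)} → 𝒢^{r(g)}`. -/
def leftMul {x y : X} (g : x ⟶ y) (h : RangeFibre x) : RangeFibre y :=
  ⟨Arr.mk (h.1.hom ≫ eqToHom h.2 ≫ g), rfl⟩

variable (X) in
/-- A (left) Haar system: a family of Radon measures `μˣ` with full support on the fibres `𝒢ˣ`,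
depending continuously on `x` and invariant under left translation. -/
structure HaarSystem [TopologicalSpace X] [TopologicalSpace (Arr X)] [MeasurableSpace (Arr X)] where
  μ : ∀ x : X, Measure (RangeFibre x)
  regular : ∀ x, (μ x).Regular
  fullSupport : ∀ x, (μ x).IsOpenPosMeasure
  continuous_integral : ∀ f : Arr X → ℝ, Continuous f → HasCompactSupport f →
    Continuous (fun x : X => ∫ h : RangeFibre x, f h.1 ∂(μ x))
  left_invariant : ∀ {x y : X} (g : x ⟶ y), Measure.map (leftMul g) (μ x) = μ y

end Top

/-! ## The simplicial space `𝒢_•` -/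

section Nerve

/-- The space `𝒢_n = Hom([n] × [n], 𝒢)` of strict morphisms `φ` from the pair groupoid
`[n] × [n] ⇉ [n]` to `𝒢`.  The arrow `φ(i, j)` has source `φ(j)` and range `φ(i)`, and
`φ(i, j) φ(j, k) = φ(i, k)`. -/
structure Nerve (X : Type u) [Groupoid.{v} X] (n : ℕ) : Type (max u v) where
  obj : Fin (n + 1) → X
  map : ∀ i j : Fin (n + 1), obj j ⟶ obj i
  map_id : ∀ i, map i i = 𝟙 (obj i)
  map_comp : ∀ i j k, map j k ≫ map i j = map i k

variable {X : Type u} [Groupoid.{v} X]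

/-- The topology of `𝒢_n`, induced from the product topology on families of arrows. -/
instance [TopologicalSpace (Arr X)] (n : ℕ) : TopologicalSpace (Nerve X n) :=
  TopologicalSpace.induced
    (fun (φ : Nerve X n) => fun i j : Fin (n + 1) => Arr.mk (φ.map i j)) inferInstance

/-- The last vertex of `φ = (g₁, …, gₙ) ∈ 𝒢_n`, i.e. `s(gₙ)`. -/
abbrev Nerve.last {n : ℕ} (φ : Nerve X n) : X := φ.obj (Fin.last n)

/-- The map `𝒢_n → 𝒢_m`, `φ ↦ φ ∘ (f × f)`, induced by `f : [m] → [n]`. -/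
abbrev Nerve.pull {m n : ℕ} (f : Fin (m + 1) → Fin (n + 1)) (φ : Nerve X n) : Nerve X m where
  obj i := φ.obj (f i)
  map i j := φ.map (f i) (f j)
  map_id i := φ.map_id (f i)
  map_comp i j k := φ.map_comp (f i) (f j) (f k)

theorem Nerve.continuous_arrow [TopologicalSpace (Arr X)] {n : ℕ} (i j : Fin (n + 1)) :
    Continuous (fun φ : Nerve X n => Arr.mk (φ.map i j)) :=
  (continuous_apply_apply i j).comp
    (continuous_induced_dom (f := fun (φ : Nerve X n) => fun i j => Arr.mk (φ.map i j)))

theorem Nerve.continuous_pull [TopologicalSpace (Arr X)] {m n : ℕ}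
    (f : Fin (m + 1) → Fin (n + 1)) : Continuous (Nerve.pull (X := X) f) :=
  continuous_induced_rng.2
    (continuous_pi fun i => continuous_pi fun j => Nerve.continuous_arrow (f i) (f j))

theorem Nerve.continuous_obj [TopologicalSpace X] [TopologicalSpace (Arr X)]
    [TopologicalGroupoid X] {n : ℕ} (i : Fin (n + 1)) :
    Continuous (fun φ : Nerve X n => φ.obj i) :=
  (TopologicalGroupoid.continuous_src (X := X)).comp (Nerve.continuous_arrow i i)

end Nerve

/-! ## Representations and the sheaf `E^•` on `𝒢_•` -/

section Rep

variable {X : Type u} [Groupoid.{v} X] [TopologicalSpace X] [TopologicalSpace (Arr X)]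
  (F : Type*) [NormedAddCommGroup F] [NormedSpace ℝ F]
  (E : X → Type w) [∀ x, AddCommGroup (E x)] [∀ x, Module ℝ (E x)]
  [∀ x, TopologicalSpace (E x)] [TopologicalSpace (TotalSpace F E)]
  [FiberBundle F E]

/-- A representation of `𝒢` on the vector bundle `E → X`: a continuous left action of `𝒢` on the
total space of `E` by linear maps `E_{s(g)} → E_{r(g)}`.  The domain `𝒢 ×_{s, X} E` of the action
is the total space of the pullback of `E` along `s`. -/
structure GroupoidRep where
  act : ∀ {x y : X}, (x ⟶ y) → (E x →ₗ[ℝ] E y)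
  act_id : ∀ (x : X) (e : E x), act (𝟙 x) e = e
  act_comp : ∀ {x y z : X} (g : x ⟶ y) (h : y ⟶ z) (e : E x), act (g ≫ h) e = act h (act g e)
  continuous_act : Continuous
    (fun q : TotalSpace F ((fun g : Arr X => g.src) *ᵖ E) =>
      TotalSpace.mk' F q.proj.tgt (act q.proj.hom q.snd))

variable {E} in
theorem continuous_section_add [VectorBundle ℝ F E] {B : Type*} [TopologicalSpace B] {b : B → X}
    {s t : ∀ y, E (b y)}
    (hs : Continuous (fun y => TotalSpace.mk' F (b y) (s y)))
    (ht : Continuous (fun y => TotalSpace.mk' F (b y) (t y))) :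
    Continuous (fun y => TotalSpace.mk' F (b y) (s y + t y)) := by
  rw [continuous_iff_continuousAt] at *
  intro y
  have h1 := (FiberBundle.continuousAt_totalSpace F _).1 (hs y)
  have h2 := (FiberBundle.continuousAt_totalSpace F _).1 (ht y)
  refine (FiberBundle.continuousAt_totalSpace F _).2 ⟨h1.1, ?_⟩
  refine (h1.2.add h2.2).congr ?_
  have hmem : ∀ᶠ z in 𝓝 y, b z ∈ (trivializationAt F E (b y)).baseSet :=
    h1.1.eventually ((trivializationAt F E (b y)).open_baseSet.mem_nhds
      (FiberBundle.mem_baseSet_trivializationAt F E (b y)))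
  filter_upwards [hmem] with z hz
  exact (((trivializationAt F E (b y)).linear ℝ hz).map_add (s z) (t z)).symm

variable {E} in
theorem continuous_section_neg [VectorBundle ℝ F E] {B : Type*} [TopologicalSpace B] {b : B → X}
    {s : ∀ y, E (b y)} (hs : Continuous (fun y => TotalSpace.mk' F (b y) (s y))) :
    Continuous (fun y => TotalSpace.mk' F (b y) (-s y)) := by
  rw [continuous_iff_continuousAt] at *
  intro y
  have h1 := (FiberBundle.continuousAt_totalSpace F _).1 (hs y)
  refine (FiberBundle.continuousAt_totalSpace F _).2 ⟨h1.1, ?_⟩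
  refine h1.2.neg.congr ?_
  have hmem : ∀ᶠ z in 𝓝 y, b z ∈ (trivializationAt F E (b y)).baseSet :=
    h1.1.eventually ((trivializationAt F E (b y)).open_baseSet.mem_nhds
      (FiberBundle.mem_baseSet_trivializationAt F E (b y)))
  filter_upwards [hmem] with z hz
  exact (((trivializationAt F E (b y)).linear ℝ hz).map_neg (s z)).symm

variable [TopologicalGroupoid X] [VectorBundle ℝ F E]

/-- The group `E^n(A)` of continuous sections over `A ⊆ 𝒢_n` of the bundle
`𝒢_n ×_X E → 𝒢_n` whose fibre over `φ = (g₁, …, gₙ)` is `E_{s(gₙ)}`. -/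
def sections {n : ℕ} (A : Set (Nerve X n)) : AddSubgroup (∀ φ : A, E φ.1.last) where
  carrier := {s | Continuous (fun φ : A => TotalSpace.mk' F φ.1.last (s φ))}
  add_mem' hs ht := continuous_section_add F hs ht
  zero_mem' := (Bundle.Trivialization.continuous_zeroSection ℝ (F := F) (E := E)).comp
    ((Nerve.continuous_obj (Fin.last n)).comp continuous_subtype_val)
  neg_mem' hs := continuous_section_neg F hs

variable {F E}

theorem GroupoidRep.continuous_res (ρ : GroupoidRep F E) {m n : ℕ}
    (f : Fin (m + 1) → Fin (n + 1)) {A : Set (Nerve X n)} {B : Set (Nerve X m)}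
    (h : Set.MapsTo (Nerve.pull f) A B) (s : sections F E B) :
    Continuous (fun φ : A => TotalSpace.mk' F φ.1.last
      (ρ.act (φ.1.map (Fin.last n) (f (Fin.last m))) (s.1 ⟨Nerve.pull f φ.1, h φ.2⟩))) := by
  have key : Continuous (fun φ : A =>
      (TotalSpace.mk' F (E := (fun g : Arr X => g.src) *ᵖ E)
        (Arr.mk (φ.1.map (Fin.last n) (f (Fin.last m))))
        (s.1 ⟨Nerve.pull f φ.1, h φ.2⟩))) := by
    rw [(inducing_pullbackTotalSpaceEmbedding F E (fun g : Arr X => g.src)).continuous_iff]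
    refine Continuous.prodMk ?_ ?_
    · exact (Nerve.continuous_arrow _ _).comp continuous_subtype_val
    · exact s.2.comp (((Nerve.continuous_pull f).comp continuous_subtype_val).subtype_mk
        (fun φ => h φ.2))
  exact ρ.continuous_act.comp key

/-- The restriction map `f̃^* : E^m(B) → E^n(A)` of the simplicial sheaf `E^•` attached to
`f : [m] → [n]`, for `f̃(A) ⊆ B`.  The simplicial structure of `𝒢_• ×_X E` is
`f̃(φ, t) = (f̃ φ, φ(f(m), n) · t)`, so that the pulled back section is
`(f̃^* s)(φ) = φ(n, f(m)) · s(f̃ φ)`. -/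
def GroupoidRep.res (ρ : GroupoidRep F E) {m n : ℕ}
    (f : Fin (m + 1) → Fin (n + 1)) {A : Set (Nerve X n)} {B : Set (Nerve X m)}
    (h : Set.MapsTo (Nerve.pull f) A B) : sections F E B →+ sections F E A where
  toFun s := ⟨fun φ => ρ.act (φ.1.map (Fin.last n) (f (Fin.last m)))
    (s.1 ⟨Nerve.pull f φ.1, h φ.2⟩), ρ.continuous_res f h s⟩
  map_zero' := by
    apply Subtype.ext
    funext φ
    exact map_zero (ρ.act (φ.1.map (Fin.last n) (f (Fin.last m))))
  map_add' s t := by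
    apply Subtype.ext
    funext φ
    exact map_add (ρ.act (φ.1.map (Fin.last n) (f (Fin.last m))))
      (s.1 ⟨Nerve.pull f φ.1, h φ.2⟩) (t.1 ⟨Nerve.pull f φ.1, h φ.2⟩)

variable (F E) in
/-- Restriction of sections to a smaller set. -/
def restrict {n : ℕ} {A B : Set (Nerve X n)} (h : A ⊆ B) : sections F E B →+ sections F E A where
  toFun s := ⟨fun φ => s.1 ⟨φ.1, h φ.2⟩,
    Continuous.comp (g := fun φ : B => TotalSpace.mk' F φ.1.last (s.1 φ)) s.2
      (continuous_subtype_val.subtype_mk (fun φ : A => h φ.2))⟩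
  map_zero' := rfl
  map_add' _ _ := rfl

end Rep

/-! ## Open covers of `𝒢_•` -/

section Cover

variable (X : Type u) [Groupoid.{v} X] [TopologicalSpace (Arr X)]

/-- An open cover of the simplicial space `𝒢_•`: a sequence of open covers `(U^n_j)_{j ∈ J_n}`
of the spaces `𝒢_n`. -/
structure OpenCover : Type (max u v + 1) where
  J : ℕ → Type (max u v)
  U : ∀ n, J n → Set (Nerve X n)
  isOpen_U : ∀ n j, IsOpen (U n j)
  covers : ∀ n (φ : Nerve X n), ∃ j, φ ∈ U n j

/-- A pre-simplicial open cover of `𝒢_•`: the index sets form a pre-simplicial set, and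
`f̃(U^n_j) ⊆ U^m_{f̃(j)}` for all increasing `f : [m] → [n]`. -/
structure PreSimplicialCover : Type (max u v + 1) extends OpenCover X where
  face : ∀ {m n : ℕ}, (Fin (m + 1) ↪o Fin (n + 1)) → J n → J m
  face_id : ∀ {n : ℕ} (j : J n), face (RelEmbedding.refl _) j = j
  face_comp : ∀ {k m n : ℕ} (g : Fin (k + 1) ↪o Fin (m + 1)) (f : Fin (m + 1) ↪o Fin (n + 1))
    (j : J n), face (g.trans f) j = face g (face f j)
  mapsTo : ∀ {m n : ℕ} (f : Fin (m + 1) ↪o Fin (n + 1)) (j : J n),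
    Set.MapsTo (Nerve.pull f) (U n j) (U m (face f j))

variable {X}

/-- An `N`-simplicial structure on the `N`-skeleton of an open cover: the index sets `J_n`,
`n ≤ N`, form an `N`-truncated simplicial set and `f̃(U^n_j) ⊆ U^m_{f̃(j)}` for all nondecreasing
`f : [m] → [n]`, `m, n ≤ N`. -/
structure OpenCover.NSimplicialStructure (𝒰 : OpenCover X) (N : ℕ) where
  app : ∀ {m n : ℕ}, m ≤ N → n ≤ N → (Fin (m + 1) →o Fin (n + 1)) → 𝒰.J n → 𝒰.J m
  app_id : ∀ {n : ℕ} (hn : n ≤ N) (j : 𝒰.J n), app hn hn OrderHom.id j = j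
  app_comp : ∀ {k m n : ℕ} (hk : k ≤ N) (hm : m ≤ N) (hn : n ≤ N)
    (g : Fin (k + 1) →o Fin (m + 1)) (f : Fin (m + 1) →o Fin (n + 1)) (j : 𝒰.J n),
    app hk hn (f.comp g) j = app hk hm g (app hm hn f j)
  mapsTo : ∀ {m n : ℕ} (hm : m ≤ N) (hn : n ≤ N) (f : Fin (m + 1) →o Fin (n + 1)) (j : 𝒰.J n),
    Set.MapsTo (Nerve.pull f) (𝒰.U n j) (𝒰.U m (app hm hn f j))

/-- The set `Λ_n` of families `λ` assigning to each increasing map `f : [k] → [n]` an index in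
`J_k` (there are such maps `f` only for `k ≤ n`). -/
abbrev OpenCover.Lam (𝒰 : OpenCover X) (n : ℕ) : Type (max u v) :=
  ∀ k : ℕ, (Fin (k + 1) ↪o Fin (n + 1)) → 𝒰.J k

/-- The pre-simplicial cover `♮𝒰` generated by an open cover `𝒰`: it is indexed by `Λ_n`, with
`U^n_λ = ⋂_f f̃⁻¹(U^k_{λ(f)})` and `(f̃ λ)(g) = λ(f ∘ g)`. -/
def OpenCover.natural (𝒰 : OpenCover X) : PreSimplicialCover X where
  J := 𝒰.Lam
  U n l := {φ | ∀ (k : ℕ) (f : Fin (k + 1) ↪o Fin (n + 1)), Nerve.pull f φ ∈ 𝒰.U k (l k f)}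
  isOpen_U n l := by
    have h : {φ : Nerve X n | ∀ (k : ℕ) (f : Fin (k + 1) ↪o Fin (n + 1)),
        Nerve.pull f φ ∈ 𝒰.U k (l k f)} =
        ⋂ k ∈ Set.Iic n, ⋂ f : Fin (k + 1) ↪o Fin (n + 1),
          Nerve.pull f ⁻¹' (𝒰.U k (l k f)) := by
      ext φ
      simp only [Set.mem_ofPred_eq, Set.mem_iInter, Set.mem_preimage, Set.mem_Iic]
      refine ⟨fun h k _ f => h k f, fun h k f => h k ?_ f⟩
      have := Fintype.card_le_of_injective f f.injective
      simpa using this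
    rw [h]
    exact (Set.finite_Iic n).isOpen_biInter fun k _ => isOpen_iInter_of_finite fun f =>
      (𝒰.isOpen_U k _).preimage (Nerve.continuous_pull f)
  covers n φ := by
    choose j hj using fun (k : ℕ) (f : Fin (k + 1) ↪o Fin (n + 1)) =>
      𝒰.covers k (Nerve.pull f φ)
    exact ⟨j, hj⟩
  face f l := fun k g => l k (g.trans f)
  face_id _ := rfl
  face_comp _ _ _ := rfl
  mapsTo f _ := fun _ hφ k g => hφ k (g.trans f)

/-- A refinement `θ : 𝒱 → 𝒰`, exhibiting `𝒱` as finer than `𝒰`. -/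
structure Refinement (𝒰 𝒱 : OpenCover X) where
  app : ∀ n, 𝒱.J n → 𝒰.J n
  subset : ∀ n i, 𝒱.U n i ⊆ 𝒰.U n (app n i)

/-- The pre-simplicial refinement `♮θ : ♮𝒱 → ♮𝒰` induced by a refinement. -/
def Refinement.natural {𝒰 𝒱 : OpenCover X} (θ : Refinement 𝒰 𝒱) :
    Refinement 𝒰.natural.toOpenCover 𝒱.natural.toOpenCover where
  app _ l := fun k f => θ.app k (l k f)
  subset _ _ := fun _ hφ k f => θ.subset k _ (hφ k f)

end Cover

/-! ## Čech cohomology -/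

section Cech

variable {X : Type u} [Groupoid.{v} X] [TopologicalSpace X] [TopologicalSpace (Arr X)]
  [TopologicalGroupoid X]
  {F : Type*} [NormedAddCommGroup F] [NormedSpace ℝ F]
  {E : X → Type w} [∀ x, AddCommGroup (E x)] [∀ x, Module ℝ (E x)]
  [∀ x, TopologicalSpace (E x)] [TopologicalSpace (TotalSpace F E)]
  [FiberBundle F E] [VectorBundle ℝ F E]

variable (F E) in
/-- The group `C_ss^n(𝒰, E^•) = ∏_{j ∈ J_n} E^n(U^n_j)` of `n`-cochains. -/
abbrev Cochain (𝒰 : OpenCover X) (n : ℕ) : Type _ := ∀ j : 𝒰.J n, sections F E (𝒰.U n j)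

/-- The differential `(dc)_j = ∑_k (-1)^k ε̃_k^* (c_{ε̃_k(j)})`. -/
def differential (ρ : GroupoidRep F E) (𝒰 : PreSimplicialCover X) (n : ℕ) :
    Cochain F E 𝒰.toOpenCover n →+ Cochain F E 𝒰.toOpenCover (n + 1) :=
  AddMonoidHom.pi fun j => ∑ k : Fin (n + 2), ((-1 : ℤ) ^ (k : ℕ)) •
    (ρ.res (Fin.succAboveOrderEmb k) (𝒰.mapsTo (Fin.succAboveOrderEmb k) j)).comp
      (Pi.evalAddMonoidHom _ (𝒰.face (Fin.succAboveOrderEmb k) j))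

/-- The `n`-coboundaries: the image of `d^{n-1}`, where `d^{-1} = 0`. -/
def coboundaries (ρ : GroupoidRep F E) (𝒰 : PreSimplicialCover X) :
    ∀ n : ℕ, AddSubgroup (Cochain F E 𝒰.toOpenCover n)
  | 0 => ⊥
  | n + 1 => (differential ρ 𝒰 n).range

/-- The cohomology group `H^n_ss(𝒰, E^•) = ker d^n / im d^{n-1}` of a pre-simplicial cover. -/
abbrev CohomologySS (ρ : GroupoidRep F E) (𝒰 : PreSimplicialCover X) (n : ℕ) : Type _ :=
  (differential ρ 𝒰 n).ker ⧸ (coboundaries ρ 𝒰 n).addSubgroupOf (differential ρ 𝒰 n).ker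

/-- The cohomology group `H^n(𝒰, E^•) = H^n_ss(♮𝒰, E^•)` of an arbitrary open cover. -/
abbrev CoverCohomology (ρ : GroupoidRep F E) (𝒰 : OpenCover X) (n : ℕ) : Type _ :=
  CohomologySS ρ 𝒰.natural n

variable (F E) in
/-- The map on cochains `(θ^* c)_i = c_{θ(i)}|_{V_i}` induced by a refinement. -/
def Refinement.cochainMap {𝒰 𝒱 : OpenCover X} (θ : Refinement 𝒰 𝒱) (n : ℕ) :
    Cochain F E 𝒰 n →+ Cochain F E 𝒱 n :=
  AddMonoidHom.pi fun i => (restrict F E (θ.subset n i)).comp (Pi.evalAddMonoidHom _ (θ.app n i))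

theorem Refinement.cochainMap_differential (ρ : GroupoidRep F E) {𝒰 𝒱 : OpenCover X}
    (θ : Refinement 𝒰 𝒱) (n : ℕ) (c : Cochain F E 𝒰.natural.toOpenCover n) :
    θ.natural.cochainMap F E (n + 1) (differential ρ 𝒰.natural n c) =
      differential ρ 𝒱.natural n (θ.natural.cochainMap F E n c) := by
  funext i
  simp only [differential, Refinement.cochainMap, AddMonoidHom.pi_apply, AddMonoidHom.comp_apply,
    AddMonoidHom.finsetSum_apply, AddMonoidHom.smul_apply, map_sum, map_zsmul,
    Pi.evalAddMonoidHom_apply]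
  rfl

theorem Refinement.cochainMap_coboundaries (ρ : GroupoidRep F E) {𝒰 𝒱 : OpenCover X}
    (θ : Refinement 𝒰 𝒱) (n : ℕ) (c : Cochain F E 𝒰.natural.toOpenCover n)
    (hc : c ∈ coboundaries ρ 𝒰.natural n) :
    θ.natural.cochainMap F E n c ∈ coboundaries ρ 𝒱.natural n := by
  cases n with
  | zero =>
    have hc' : c = 0 := hc
    subst hc'
    rw [map_zero]
    exact zero_mem _
  | succ n =>
    obtain ⟨b, rfl⟩ := hc
    exact ⟨θ.natural.cochainMap F E n b, (θ.cochainMap_differential ρ n b).symm⟩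

/-- The map on cocycles induced by a refinement. -/
def Refinement.cocycleMap (ρ : GroupoidRep F E) {𝒰 𝒱 : OpenCover X}
    (θ : Refinement 𝒰 𝒱) (n : ℕ) :
    (differential ρ 𝒰.natural n).ker →+ (differential ρ 𝒱.natural n).ker :=
  ((θ.natural.cochainMap F E n).comp (differential ρ 𝒰.natural n).ker.subtype).codRestrict _
    (fun c => by
      have hc : differential ρ 𝒰.natural n c.1 = 0 := c.2
      rw [AddMonoidHom.mem_ker, AddMonoidHom.comp_apply, AddSubgroup.subtype_apply,
        ← θ.cochainMap_differential ρ n, hc, map_zero])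

/-- The homomorphism `θ^* : H^n(𝒰, E^•) → H^n(𝒱, E^•)` induced by a refinement. -/
def Refinement.cohomologyMap (ρ : GroupoidRep F E) {𝒰 𝒱 : OpenCover X}
    (θ : Refinement 𝒰 𝒱) (n : ℕ) : CoverCohomology ρ 𝒰 n →+ CoverCohomology ρ 𝒱 n :=
  QuotientAddGroup.map _ _ (θ.cocycleMap ρ n)
    (fun c hc => θ.cochainMap_coboundaries ρ n c.1 hc)

variable (X) in
/-- The collection `𝔑(n)` of the open covers of `𝒢_•` whose `N`-skeleton admits an `N`-simplicial
structure for some `N ≥ n + 1`. -/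
abbrev CechIndex (n : ℕ) : Type (max u v + 1) :=
  {𝒰 : OpenCover X // ∃ N, n + 1 ≤ N ∧ Nonempty (𝒰.NSimplicialStructure N)}

open scoped Classical in
/-- The relations defining the direct limit: `x ∈ H^n(𝒰, E^•)` is identified with its image
`θ^* x ∈ H^n(𝒱, E^•)`, for every refinement `θ : 𝒱 → 𝒰` in `𝔑(n)`. -/
def cechRelations (ρ : GroupoidRep F E) (n : ℕ) :
    AddSubgroup (DirectSum (CechIndex X n) fun 𝒰 => CoverCohomology ρ 𝒰.1 n) :=
  AddSubgroup.closure {z | ∃ (𝒰 𝒱 : CechIndex X n) (θ : Refinement 𝒰.1 𝒱.1)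
    (x : CoverCohomology ρ 𝒰.1 n),
    z = DirectSum.of (fun 𝒲 : CechIndex X n => CoverCohomology ρ 𝒲.1 n) 𝒱
          (θ.cohomologyMap ρ n x) -
        DirectSum.of (fun 𝒲 : CechIndex X n => CoverCohomology ρ 𝒲.1 n) 𝒰 x}

/-- The Čech cohomology group `Ȟ^n(𝒢_•, E^•)`: the direct limit of the groups `H^n(𝒰, E^•)` over
the covers `𝒰 ∈ 𝔑(n)`, ordered by refinement. -/
abbrev CechCohomology (ρ : GroupoidRep F E) (n : ℕ) : Type _ :=
  (DirectSum (CechIndex X n) fun 𝒰 => CoverCohomology ρ 𝒰.1 n) ⧸ cechRelations ρ n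

end Cech

end GroupoidCech

end

open GroupoidCech

noncomputable section

namespace GroupoidCech

/-! ## Extending a point of the nerve by one arrow -/

section NerveSnoc

variable {X : Type u} [Groupoid.{v} X]

/-! The complex of every single open cover already has no cohomology in positive degrees, so the
direct limit vanishes. The contraction is averaging over the groupoid, as for compact groups,
combined with averaging over cover indices.

Properness and the Haar system give a cutoff function (`HaarSystem.exists_cutoff`): a continuous `f`
on `X` with `∫ f(s(γ)) dμˣ(γ) = 1` for every `x`, whose integrands have supports in one compact set
for all `x` near a given point. Bumps on `X` are glued by a partition of unity on `X/𝒢`, and the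
result is divided by its fibre integral, which is constant on orbits.

Let `c` be a cocycle of degree `n + 1`. For `φ ∈ 𝒢_n` and `γ` with range the last vertex of `φ`, let
`(φ, γ) ∈ 𝒢_{n+1}` be the extended point (`Nerve.snoc`). An index `l ∈ Λ_n` has many extensions `l'
∈ Λ_{n+1}`; they are averaged with weights from partitions of unity on the faces that contain the
new vertex (`extWeight`, `extSection`). The homotopy is `(hc)_l(φ) = ∫ f(s(γ)) γ · (mean over l' of
c_{l'}(φ, γ)) dμ(γ)`.

For `φ ∈ 𝒢_{n+1}`, left invariance of `μ` brings all the integrals in `d(hc)(φ)` to the same fibre.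
Since the marginals of product weights are product weights, the integrand is then the mean of all
terms of `dc` at `(φ, γ)` except the last (`homotopyIntegrand_face`). As `dc = 0`, these terms add
up to `(-1)^{n+1} c_l(φ)` (`sum_homotopyIntegrand_face`), which depends neither on `γ` nor on the
extension. Since all the weights have total mass one, `d(hc) = (-1)^{n+1} c`
(`HaarSystem.exists_differential_eq`). -/

theorem Nerve.ext_arrow {n : ℕ} {φ ψ : Nerve X n}
    (h : ∀ i j, Arr.mk (φ.map i j) = Arr.mk (ψ.map i j)) : φ = ψ := by
  obtain ⟨o, m, _, _⟩ := φ
  obtain ⟨o', m', _, _⟩ := ψ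
  have ho : o = o' := funext fun i => congrArg Arr.src (h i i)
  subst ho
  have hm : m = m' := by
    funext i j
    simpa using h i j
  subst hm
  rfl

theorem Arr.mk_eqToHom_comp {x y z : X} (h : x = y) (g : y ⟶ z) :
    Arr.mk (eqToHom h ≫ g) = Arr.mk g := by
  subst h
  simp

theorem inv_comp_comp_inv {x x' y y' z : X} (a : x ⟶ y) (b : x' ⟶ y') (e : y = z) (e' : y' = z)
    {w : X} (g : z ⟶ w) :
    (a ≫ eqToHom e ≫ g) ≫ Groupoid.inv (b ≫ eqToHom e' ≫ g) =
      a ≫ eqToHom (e.trans e'.symm) ≫ Groupoid.inv b := by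
  subst e
  subst e'
  simp

/-- The point of the nerve given by a family of arrows with the same range `z`. -/
def Nerve.ofFan {n : ℕ} {z : X} (b : Fin (n + 1) → RangeFibre z) : Nerve X n where
  obj i := (b i).1.src
  map i j := (b j).1.hom ≫ eqToHom ((b j).2.trans (b i).2.symm) ≫ Groupoid.inv (b i).1.hom
  map_id i := by simp
  map_comp i j k := by simp

theorem Nerve.ofFan_map_last {n : ℕ} (φ : Nerve X n) :
    Nerve.ofFan (fun i => (⟨Arr.mk (φ.map (Fin.last n) i), rfl⟩ : RangeFibre φ.last)) = φ := by
  refine Nerve.ext_arrow fun i j => ?_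
  have h : φ.map (Fin.last n) j ≫ Groupoid.inv (φ.map (Fin.last n) i) = φ.map i j := by
    rw [← φ.map_comp (Fin.last n) i j, Category.assoc, Groupoid.comp_inv, Category.comp_id]
  simp only [Nerve.ofFan, eqToHom_refl, Category.id_comp]
  rw [h]

/-- A fan enters only through the quotients `bᵢ⁻¹ bⱼ`, in which a common left factor cancels. This
is the source of the translation of `γ` in `Nerve.pull_succAbove_snoc`. -/
theorem Nerve.ofFan_leftMul {n : ℕ} {y z : X} (g : y ⟶ z) (b : Fin (n + 1) → RangeFibre y) :
    Nerve.ofFan (fun i => leftMul g (b i)) = Nerve.ofFan b := by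
  refine Nerve.ext_arrow fun i j => ?_
  have h := inv_comp_comp_inv (b j).1.hom (b i).1.hom (b j).2 (b i).2 g
  simp only [Nerve.ofFan, leftMul, eqToHom_refl, Category.id_comp]
  rw [h]

/-- The point `(g₁, …, gₙ, γ)` of `𝒢_{n+1}`. -/
def Nerve.snoc {n : ℕ} (φ : Nerve X n) (γ : RangeFibre φ.last) : Nerve X (n + 1) :=
  Nerve.ofFan (Fin.snoc (α := fun _ => RangeFibre φ.last)
    (fun i => ⟨Arr.mk (φ.map (Fin.last n) i), rfl⟩) γ)

theorem Nerve.pull_castSucc_snoc {n : ℕ} (φ : Nerve X n) (γ : RangeFibre φ.last) :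
    Nerve.pull Fin.castSucc (φ.snoc γ) = φ := by
  refine Eq.trans ?_ φ.ofFan_map_last
  change Nerve.ofFan (fun i : Fin (n + 1) => Fin.snoc (α := fun _ => RangeFibre φ.last)
    (fun i => ⟨Arr.mk (φ.map (Fin.last n) i), rfl⟩) γ i.castSucc) = _
  congr 1
  funext i
  simp

theorem Nerve.snoc_last {n : ℕ} (φ : Nerve X n) (γ : RangeFibre φ.last) :
    (φ.snoc γ).last = γ.1.src := by
  change (Fin.snoc (α := fun _ => RangeFibre φ.last)
    (fun i => ⟨Arr.mk (φ.map (Fin.last n) i), rfl⟩) γ (Fin.last (n + 1)) : RangeFibre φ.last).1.src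
      = _
  rw [Fin.snoc_last]

/-- If `k` is the last vertex of `φ`, deleting it moves the base of the fan to the preceding vertex,
and `γ` has to be translated there. For the other `k` the translating arrow is a unit, so one
formula covers both cases. -/
theorem Nerve.pull_succAbove_snoc {n : ℕ} (φ : Nerve X (n + 1)) (γ : RangeFibre φ.last)
    (k : Fin (n + 2)) :
    Nerve.pull (k.castSucc.succAbove) (φ.snoc γ) =
      (Nerve.pull k.succAbove φ).snoc
        (leftMul (φ.map (k.succAbove (Fin.last n)) (Fin.last (n + 1))) γ) := by
  have h := Nerve.ofFan_leftMul (φ.map (k.succAbove (Fin.last n)) (Fin.last (n + 1)))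
    (Fin.snoc (α := fun _ => RangeFibre φ.last)
      (fun i => ⟨Arr.mk (φ.map (Fin.last (n + 1)) (k.succAbove i)), rfl⟩) γ)
  refine Eq.trans ?_ (h.symm.trans ?_)
  · change Nerve.ofFan (fun i : Fin (n + 2) => Fin.snoc (α := fun _ => RangeFibre φ.last)
      (fun i => ⟨Arr.mk (φ.map (Fin.last (n + 1)) i), rfl⟩) γ (k.castSucc.succAbove i)) = _
    congr 1
    funext i
    refine Fin.lastCases ?_ (fun i => ?_) i
    · simp
    · rw [Fin.castSucc_succAbove_castSucc, Fin.snoc_castSucc, Fin.snoc_castSucc]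
  · change _ = Nerve.ofFan _
    congr 1
    funext i
    refine Fin.lastCases ?_ (fun i => ?_) i
    · simp
    · rw [Fin.snoc_castSucc, Fin.snoc_castSucc]
      apply Subtype.ext
      simp only [leftMul, eqToHom_refl, Category.id_comp]
      rw [φ.map_comp]

end NerveSnoc

/-! ### Topology of the nerve and of the space of arrows -/

section NerveTop

variable {X : Type u} [Groupoid.{v} X] [TopologicalSpace X] [TopologicalSpace (Arr X)]
  [TopologicalGroupoid X]

theorem continuous_comp_arrow {Y : Type*} [TopologicalSpace Y] {f g : Y → Arr X}
    (hf : Continuous f) (hg : Continuous g) (e : ∀ y, (f y).tgt = (g y).src) :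
    Continuous fun y => Arr.mk ((f y).hom ≫ eqToHom (e y) ≫ (g y).hom) := by
  have h : Continuous fun y =>
      (⟨(f y).hom, eqToHom (e y) ≫ (g y).hom⟩ : ComposablePair X) := by
    refine continuous_induced_rng.2 (hf.prodMk (hg.congr fun y => ?_))
    exact (Arr.mk_eqToHom_comp (e y) (g y).hom).symm
  exact (TopologicalGroupoid.continuous_comp (X := X)).comp h

theorem continuous_ldiv {Y : Type*} [TopologicalSpace Y] {f g : Y → Arr X}
    (hf : Continuous f) (hg : Continuous g) (e : ∀ y, (f y).tgt = (g y).tgt) :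
    Continuous fun y => Arr.mk ((f y).hom ≫ eqToHom (e y) ≫ Groupoid.inv (g y).hom) :=
  continuous_comp_arrow hf ((TopologicalGroupoid.continuous_inv (X := X)).comp hg) e

theorem Nerve.continuous_of_arrow {Y : Type*} [TopologicalSpace Y] {n : ℕ} {f : Y → Nerve X n}
    (h : ∀ i j, Continuous fun y => Arr.mk ((f y).map i j)) : Continuous f :=
  continuous_induced_rng.2 (continuous_pi fun i => continuous_pi fun j => h i j)

theorem Nerve.continuous_snoc {n : ℕ} {Y : Type*} [TopologicalSpace Y] {f : Y → Nerve X n}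
    {g : ∀ y, RangeFibre (f y).last} (hf : Continuous f) (hg : Continuous fun y => (g y).1) :
    Continuous fun y => (f y).snoc (g y) := by
  have key : ∀ i : Fin (n + 2), Continuous fun y =>
      (Fin.snoc (α := fun _ => RangeFibre (f y).last)
        (fun i => ⟨Arr.mk ((f y).map (Fin.last n) i), rfl⟩) (g y) i : RangeFibre (f y).last).1 := by
    intro i
    refine Fin.lastCases ?_ (fun i => ?_) i
    · simpa using hg
    · simp only [Fin.snoc_castSucc]
      exact (Nerve.continuous_arrow (Fin.last n) i).comp hf
  exact Nerve.continuous_of_arrow fun i j => continuous_ldiv (key j) (key i) _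

variable (X) in
theorem isClosedEmbedding_unit [T2Space (Arr X)] :
    IsClosedEmbedding (fun x : X => Arr.mk (𝟙 x)) :=
  Function.LeftInverse.isClosedEmbedding (f := fun g : Arr X => g.src) (fun _ => rfl)
    TopologicalGroupoid.continuous_src TopologicalGroupoid.continuous_unit

variable (X) in
theorem t2Space_units [T2Space (Arr X)] : T2Space X :=
  (isClosedEmbedding_unit X).isEmbedding.t2Space

variable (X) in
theorem locallyCompactSpace_units [T2Space (Arr X)] [LocallyCompactSpace (Arr X)] :
    LocallyCompactSpace X :=
  (isClosedEmbedding_unit X).locallyCompactSpace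

theorem Nerve.t2Space [T2Space (Arr X)] (n : ℕ) : T2Space (Nerve X n) := by
  refine (T2Space.of_injective_continuous
    (f := fun (φ : Nerve X n) => fun i j : Fin (n + 1) => Arr.mk (φ.map i j)) ?_
      continuous_induced_dom)
  exact fun φ ψ h => Nerve.ext_arrow fun i j => congrFun (congrFun h i) j

/-- The constant point of `𝒢_n` at the unit `x`. -/
def Nerve.const (n : ℕ) (x : X) : Nerve X n where
  obj _ := x
  map _ _ := 𝟙 x
  map_id _ := rfl
  map_comp _ _ _ := Category.comp_id _

variable (X) in
-- The arrows form a closed subspace of the paracompact Hausdorff space `𝒢_1`, by a continuous map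
-- with a continuous left inverse. Normality is what Tietze extension needs in
-- `HaarSystem.continuousAt_integral`.
theorem normalSpace_arr [T2Space (Arr X)] [ParacompactSpace (Nerve X 1)] :
    NormalSpace (Arr X) := by
  have := Nerve.t2Space (X := X) 1
  have hc : Continuous (fun g : Arr X => (Nerve.const 0 g.tgt).snoc ⟨g, rfl⟩) := by
    refine Nerve.continuous_snoc (Nerve.continuous_of_arrow fun i j => ?_) continuous_id
    exact TopologicalGroupoid.continuous_unit.comp TopologicalGroupoid.continuous_tgt
  have hl : Function.LeftInverse (fun φ : Nerve X 1 => Arr.mk (φ.map 0 1))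
      (fun g : Arr X => (Nerve.const 0 g.tgt).snoc ⟨g, rfl⟩) := by
    intro g
    change Arr.mk (g.hom ≫ 𝟙 _ ≫ Groupoid.inv (𝟙 g.tgt)) = g
    have : Groupoid.inv (𝟙 g.tgt) = 𝟙 g.tgt := by
      rw [← Category.comp_id (Groupoid.inv (𝟙 g.tgt)), Groupoid.inv_comp]
    rw [this, Category.comp_id, Category.comp_id]
  exact (Function.LeftInverse.isClosedEmbedding hl (Nerve.continuous_arrow 0 1) hc).normalSpace

end NerveTop

/-! ## Integration along the range fibres -/

section Haar

variable {X : Type u} [Groupoid.{v} X] [TopologicalSpace X] [TopologicalSpace (Arr X)]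
  [TopologicalGroupoid X] [T2Space (Arr X)]

theorem isClosedEmbedding_rangeFibre (x : X) :
    IsClosedEmbedding (fun h : RangeFibre x => h.1) := by
  have := t2Space_units X
  exact (isClosed_singleton.preimage
    (TopologicalGroupoid.continuous_tgt (X := X))).isClosedEmbedding_subtypeVal

theorem hasCompactSupport_rangeFibre {G : Type*} [Zero G] {x : X} {S : RangeFibre x → G}
    {K : Set (Arr X)} (hK : IsCompact K) (hS : ∀ γ, S γ ≠ 0 → γ.1 ∈ K) : HasCompactSupport S :=
  HasCompactSupport.intro ((isClosedEmbedding_rangeFibre x).isCompact_preimage hK)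
    fun γ hγ => by_contra fun h => hγ (hS γ h)

variable [MeasurableSpace (Arr X)] [BorelSpace (Arr X)] (μ : HaarSystem X)

theorem HaarSystem.integrable {G : Type*} [NormedAddCommGroup G] {x : X}
    {S : RangeFibre x → G} (hc : Continuous S)
    {K : Set (Arr X)} (hK : IsCompact K) (hS : ∀ γ, S γ ≠ 0 → γ.1 ∈ K) :
    Integrable S (μ.μ x) := by
  have := μ.regular x
  exact hc.integrable_of_hasCompactSupport (hasCompactSupport_rangeFibre hK hS)

theorem continuous_leftMul {x y : X} (g : x ⟶ y) : Continuous (leftMul g) :=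
  (continuous_comp_arrow continuous_subtype_val (continuous_const (y := Arr.mk g))
    fun h => h.2).subtype_mk _

/-- Left multiplication by `g` as a homeomorphism. -/
def leftMulHomeomorph {x y : X} (g : x ⟶ y) : RangeFibre x ≃ₜ RangeFibre y where
  toFun := leftMul g
  invFun := leftMul (Groupoid.inv g)
  left_inv := by
    rintro ⟨⟨h⟩, rfl⟩
    simp [leftMul]
  right_inv := by
    rintro ⟨⟨h⟩, rfl⟩
    simp [leftMul]
  continuous_toFun := continuous_leftMul g
  continuous_invFun := continuous_leftMul _

theorem HaarSystem.integral_leftMul {G : Type*} [NormedAddCommGroup G] [NormedSpace ℝ G] {x y : X}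
    (g : x ⟶ y) (S : RangeFibre y → G) :
    ∫ h, S (leftMul g h) ∂(μ.μ x) = ∫ h, S h ∂(μ.μ y) := by
  rw [← μ.left_invariant g]
  exact ((leftMulHomeomorph g).measurableEmbedding.integral_map S).symm

variable [LocallyCompactSpace (Arr X)]

/-- The fibre product of `Y` and `𝒢` over `b : Y → X` and the range map. -/
abbrev FibreProd {Y : Type*} (b : Y → X) : Type _ := {q : Y × Arr X // q.2.tgt = b q.1}

/-- Integrals along the range fibres depend continuously on parameters. -/
theorem HaarSystem.continuousAt_integral [NormalSpace (Arr X)] {Y : Type*} [TopologicalSpace Y]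
    {b : Y → X} (hb : Continuous b) {H : ∀ y, RangeFibre (b y) → ℝ}
    (hH : Continuous fun q : FibreProd b => H q.1.1 ⟨q.1.2, q.2⟩) {y₀ : Y} {K : Set (Arr X)}
    (hK : IsCompact K) (hsupp : ∀ᶠ y in 𝓝 y₀, ∀ γ, H y γ ≠ 0 → γ.1 ∈ K) :
    ContinuousAt (fun y => ∫ γ, H y γ ∂(μ.μ (b y))) y₀ := by
  have := t2Space_units X
  have htgt := TopologicalGroupoid.continuous_tgt (X := X)
  have hfib : ∀ y, Continuous (H y) := fun y =>
    hH.comp (f := fun γ : RangeFibre (b y) => (⟨(y, γ.1), γ.2⟩ : FibreProd b))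
      ((Continuous.prodMk continuous_const continuous_subtype_val).subtype_mk _)
  -- A Haar system controls only integrals of functions defined on all of `𝒢`. By Tietze, `H y₀` is
  -- therefore extended from its closed fibre to `f`; near `y₀` the function `H y` is compared with
  -- `f * χ`, and `χ'`, equal to 1 on the support of `χ`, bounds the mass of the region where they
  -- can differ.
  obtain ⟨f, hf⟩ := ContinuousMap.exists_restrict_eq
    (s := {h : Arr X | h.tgt = b y₀}) (isClosed_singleton.preimage htgt)
    ⟨fun γ => H y₀ γ, hfib y₀⟩
  obtain ⟨χ, hχ1, -, hχc, -⟩ := exists_continuous_one_zero_of_isCompact hK isClosed_empty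
    (Set.disjoint_empty K)
  obtain ⟨χ', hχ'1, -, hχ'c, hχ'I⟩ := exists_continuous_one_zero_of_isCompact hχc isClosed_empty
    (Set.disjoint_empty _)
  have hKχ : ∀ γ, γ ∈ K → γ ∈ tsupport χ := fun γ hγ => subset_tsupport _ (by
    rw [Function.mem_support, hχ1 hγ]; exact one_ne_zero)
  have hχ0 : ∀ γ, γ ∉ tsupport χ → χ γ = 0 := fun γ hγ => image_eq_zero_of_notMem_tsupport hγ
  have h0 : ∀ γ : RangeFibre (b y₀), H y₀ γ = f γ.1 * χ γ.1 := by
    intro γ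
    have h1 : f γ.1 = H y₀ γ := congrArg (fun F => F γ) hf
    by_cases hγ : γ.1 ∈ K
    · rw [h1, hχ1 hγ, Pi.one_apply, mul_one]
    · have : H y₀ γ = 0 := by_contra fun h => hγ (hsupp.self_of_nhds γ h)
      rw [h1, this, zero_mul]
  have hfχ : Continuous fun γ => f γ * χ γ := f.continuous.mul χ.continuous
  have hfχc : HasCompactSupport fun γ => f γ * χ γ := hχc.mul_left
  have hI1 := (μ.continuous_integral _ hfχ hfχc).comp hb
  have hI2 := (μ.continuous_integral _ χ'.continuous hχ'c).comp hb
  -- The added 1 makes `M` positive and a strict bound for the integral of `χ'` at all nearby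
  -- parameters.
  set M : ℝ := (∫ γ, χ' γ.1 ∂(μ.μ (b y₀))) + 1 with hM
  have hM0 : 0 < M := by
    have : 0 ≤ ∫ γ, χ' γ.1 ∂(μ.μ (b y₀)) := integral_nonneg fun γ => (hχ'I _).1
    linarith
  rw [Metric.continuousAt_iff']
  intro ε hε
  -- Tube lemma: closeness near each point of the compact support of `χ` becomes uniform. At arrows
  -- outside the fibre over `b y₀` the condition is vacuous nearby, because `X` is Hausdorff.
  have hclose : ∀ᶠ y in 𝓝 y₀, ∀ γ ∈ tsupport χ, ∀ h : γ.tgt = b y,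
      |H y ⟨γ, h⟩ - f γ * χ γ| < ε / (2 * M) := by
    refine IsCompact.eventually_forall_of_forall_eventually hχc fun γ hγ => ?_
    by_cases h : γ.tgt = b y₀
    · have hcont : Continuous fun q : FibreProd b =>
          |H q.1.1 ⟨q.1.2, q.2⟩ - f q.1.2 * χ q.1.2| :=
        (hH.sub (hfχ.comp (continuous_snd.comp continuous_subtype_val))).abs
      have := (hcont.continuousAt (x := ⟨(y₀, γ), h⟩)).eventually_lt
        (continuousAt_const (y := ε / (2 * M))) (by
          have := h0 ⟨γ, h⟩
          simp only at this
          simp only [this, sub_self, abs_zero]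
          positivity)
      rw [nhds_subtype_eq_comap, Filter.eventually_comap] at this
      filter_upwards [this] with z hz h'
      exact hz ⟨z, h'⟩ rfl
    · have : ∀ᶠ z : Y × Arr X in 𝓝 (y₀, γ), z.2.tgt ≠ b z.1 :=
        (isOpen_ne_fun (htgt.comp continuous_snd) (hb.comp continuous_fst)).mem_nhds h
      filter_upwards [this] with z hz h'
      exact absurd h' hz
  have hint1 : ∀ᶠ y in 𝓝 y₀, dist (∫ γ, f γ.1 * χ γ.1 ∂(μ.μ (b y)))
      (∫ γ, f γ.1 * χ γ.1 ∂(μ.μ (b y₀))) < ε / 2 :=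
    Metric.continuousAt_iff'.1 hI1.continuousAt _ (half_pos hε)
  have hint2 : ∀ᶠ y in 𝓝 y₀, ∫ γ, χ' γ.1 ∂(μ.μ (b y)) < M :=
    hI2.continuousAt.eventually_lt continuousAt_const (by simp [hM])
  filter_upwards [hsupp, hclose, hint1, hint2] with y hy1 hy2 hy3 hy4
  have e0 : ∫ γ, H y₀ γ ∂(μ.μ (b y₀)) = ∫ γ, f γ.1 * χ γ.1 ∂(μ.μ (b y₀)) :=
    integral_congr_ae (Filter.Eventually.of_forall h0)
  have i1 := μ.integrable (hfib y) hK hy1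
  have i2 : Integrable (fun γ : RangeFibre (b y) => f γ.1 * χ γ.1) (μ.μ (b y)) :=
    μ.integrable (hfχ.comp continuous_subtype_val) hχc fun γ h => by
      by_contra h'
      exact h (by rw [hχ0 _ h', mul_zero])
  have i3 : Integrable (fun γ : RangeFibre (b y) => χ' γ.1) (μ.μ (b y)) :=
    μ.integrable (χ'.continuous.comp continuous_subtype_val) hχ'c fun γ h => subset_tsupport _ h
  have e1 : |∫ γ, H y γ ∂(μ.μ (b y)) - ∫ γ, f γ.1 * χ γ.1 ∂(μ.μ (b y))| ≤
      ε / (2 * M) * ∫ γ, χ' γ.1 ∂(μ.μ (b y)) := by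
    rw [← integral_sub i1 i2, ← integral_const_mul]
    refine (abs_integral_le_integral_abs).trans
      (integral_mono (i1.sub i2).abs (i3.const_mul _) fun γ => ?_)
    by_cases hγ : γ.1 ∈ tsupport χ
    · have := (hy2 γ.1 hγ γ.2).le
      have h1 : χ' γ.1 = 1 := hχ'1 hγ
      simpa [h1] using this
    · have h1 : H y γ = 0 := by_contra fun h => hγ (hKχ _ (hy1 γ h))
      simp only [h1, hχ0 _ hγ, mul_zero, sub_self, abs_zero]
      exact mul_nonneg (by positivity) (hχ'I _).1
  have e2 : ε / (2 * M) * ∫ γ, χ' γ.1 ∂(μ.μ (b y)) < ε / 2 := by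
    calc _ < ε / (2 * M) * M := by gcongr
      _ = ε / 2 := by field_simp
  rw [e0]
  rw [Real.dist_eq] at hy3 ⊢
  rw [abs_lt] at hy3 ⊢
  rw [abs_le] at e1
  constructor <;> linarith [e1.1, e1.2, hy3.1, hy3.2]

end Haar

/-! ## Cutoff functions -/

section Cutoff

variable {X : Type u} [Groupoid.{v} X] [TopologicalSpace X] [TopologicalSpace (Arr X)]
  [TopologicalGroupoid X] [T2Space (Arr X)] [LocallyCompactSpace (Arr X)]
  [MeasurableSpace (Arr X)] [BorelSpace (Arr X)] (μ : HaarSystem X)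

include μ in
-- A bump function at `g` has positive integral over the fibre of `r(g)`, by full support, hence
-- over all nearby fibres, by continuity. So nearby fibres meet any given neighbourhood of `g`.
theorem HaarSystem.isOpenMap_tgt : IsOpenMap (fun g : Arr X => g.tgt) := by
  refine IsOpenMap.of_nhds_le fun g => ?_
  intro V hV
  rw [Filter.mem_map] at hV
  obtain ⟨W, hWV, hW, hgW⟩ := mem_nhds_iff.1 hV
  obtain ⟨f, hf1, hf0, hfc, hfI⟩ := exists_continuous_one_zero_of_isCompact
    (isCompact_singleton (x := g)) hW.isClosed_compl (by simpa using hgW)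
  have := μ.fullSupport g.tgt
  have := μ.regular g.tgt
  have hpos : 0 < ∫ h : RangeFibre g.tgt, f h.1 ∂(μ.μ g.tgt) := by
    refine Continuous.integral_pos_of_hasCompactSupport_nonneg_nonzero (x := ⟨g, rfl⟩)
      (f.continuous.comp continuous_subtype_val)
      (hasCompactSupport_rangeFibre hfc fun γ h => subset_tsupport _ h) (fun γ => (hfI _).1) ?_
    simp [hf1 (Set.mem_singleton g)]
  filter_upwards [(μ.continuous_integral f f.continuous hfc).continuousAt.eventually
    (lt_mem_nhds hpos)] with x hx
  by_contra hxV
  have : ∀ h : RangeFibre x, f h.1 = 0 := fun h => hf0 fun hh => hxV (by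
    have := hWV hh
    rwa [Set.mem_preimage, h.2] at this)
  simp [this] at hx

variable (X) in
theorem continuous_orbitMk : Continuous (Quotient.mk (isIsomorphicSetoid X)) :=
  continuous_quotient_mk'

theorem orbitMk_eq_iff {x y : X} :
    Quotient.mk (isIsomorphicSetoid X) x = Quotient.mk (isIsomorphicSetoid X) y ↔
      ∃ g : Arr X, g.src = x ∧ g.tgt = y := by
  rw [Quotient.eq]
  constructor
  · rintro ⟨e⟩
    exact ⟨Arr.mk e.hom, rfl, rfl⟩
  · rintro ⟨g, rfl, rfl⟩
    exact ⟨(Groupoid.isoEquivHom _ _).symm g.hom⟩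

include μ in
theorem HaarSystem.isOpenQuotientMap_orbitMk :
    IsOpenQuotientMap (Quotient.mk (isIsomorphicSetoid X)) := by
  refine ⟨Quotient.mk_surjective, continuous_orbitMk X, fun V hV => ?_⟩
  rw [← isQuotientMap_quotient_mk'.isOpen_preimage]
  -- The saturation of `V` is `r(s⁻¹(V))`.
  convert μ.isOpenMap_tgt _ (hV.preimage (TopologicalGroupoid.continuous_src (X := X)))
  ext y
  constructor
  · rintro ⟨x, hx, hxy⟩
    obtain ⟨g, rfl, rfl⟩ := orbitMk_eq_iff.1 hxy
    exact ⟨g, hx, rfl⟩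
  · rintro ⟨g, hg, rfl⟩
    exact ⟨g.src, hg, orbitMk_eq_iff.2 ⟨g, rfl, rfl⟩⟩

include μ in
-- The graph of the orbit relation is the image of `(s, r)`, closed since proper maps are closed; an
-- open quotient by a closed relation is Hausdorff.
theorem HaarSystem.t2Space_orbitSpace (hproper : IsProperGroupoid X) :
    T2Space (OrbitSpace X) := by
  rw [t2Space_iff_of_isOpenQuotientMap μ.isOpenQuotientMap_orbitMk]
  convert hproper.isClosedMap.isClosed_range
  ext ⟨x, y⟩
  simp only [Set.mem_ofPred_eq, Set.mem_range, Prod.mk.injEq]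
  exact orbitMk_eq_iff

include μ in
/-- There is a nonnegative function which is nonzero at some point of each orbit, and whose support
is compact modulo the groupoid. -/
theorem HaarSystem.exists_precutoff [ParacompactSpace (OrbitSpace X)]
    (hproper : IsProperGroupoid X) :
    ∃ c : X → ℝ, Continuous c ∧ (∀ x, 0 ≤ c x) ∧
      (∀ x, ∃ g : Arr X, g.tgt = x ∧ c g.src ≠ 0) ∧
      ∀ x₀, ∃ K : Set (Arr X), IsCompact K ∧
        ∀ᶠ x in 𝓝 x₀, ∀ γ : RangeFibre x, c γ.1.src ≠ 0 → γ.1 ∈ K := by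
  have := t2Space_units X
  have := locallyCompactSpace_units X
  have := μ.t2Space_orbitSpace hproper
  have hbump : ∀ x : X, ∃ f : C(X, ℝ), f x = 1 ∧ HasCompactSupport f ∧ ∀ y, 0 ≤ f y := by
    intro x
    obtain ⟨f, hf1, -, hfc, hfI⟩ := exists_continuous_one_zero_of_isCompact
      (isCompact_singleton (x := x)) isClosed_empty (Set.disjoint_empty _)
    exact ⟨f, hf1 rfl, hfc, fun y => (hfI y).1⟩
  choose f hf1 hfc hf0 using hbump
  let q : X → OrbitSpace X := Quotient.mk (isIsomorphicSetoid X)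
  have hq : Continuous q := continuous_orbitMk X
  -- The sets where the bumps are positive have open images covering the orbit space. The function
  -- sought is the sum of the bumps `f i`, each multiplied by the pullback of `χ i`.
  obtain ⟨χ, hχ⟩ := PartitionOfUnity.exists_isSubordinate (s := Set.univ) isClosed_univ
    (fun x : X => q '' {y | 0 < f x y})
    (fun x => μ.isOpenQuotientMap_orbitMk.isOpenMap _
      (isOpen_lt continuous_const (f x).continuous))
    (fun o _ => by
      obtain ⟨x, rfl⟩ := Quotient.mk_surjective o
      exact Set.mem_iUnion.2 ⟨x, x, by simp [hf1 x], rfl⟩)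
  have hlf : LocallyFinite fun i => Function.support fun y => χ i (q y) * f i y :=
    (χ.locallyFinite.preimage_continuous hq).subset fun i y hy => left_ne_zero_of_mul hy
  have hnn : ∀ i y, 0 ≤ χ i (q y) * f i y := fun i y => mul_nonneg (χ.nonneg i _) (hf0 i y)
  refine ⟨fun y => ∑ᶠ i, χ i (q y) * f i y,
    continuous_finsum (fun i => ((χ i).continuous.comp hq).mul (f i).continuous) hlf,
    fun x => finsum_nonneg fun i => hnn i x, fun x => ?_, fun x₀ => ?_⟩
  · obtain ⟨i, hi⟩ : ∃ i, χ i (q x) ≠ 0 := by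
      by_contra! h
      have := χ.sum_eq_one (Set.mem_univ (q x))
      simp [h] at this
    obtain ⟨y, hy, hyx⟩ := hχ i (subset_tsupport _ hi)
    obtain ⟨g, rfl, rfl⟩ := orbitMk_eq_iff.1 hyx
    refine ⟨g, rfl, ne_of_gt (lt_of_lt_of_le ?_ (single_le_finsum i
      (hlf.point_finite g.src) fun j => hnn j g.src))⟩
    have h1 : 0 < χ i (q g.src) := by
      change q g.src = q g.tgt at hyx
      rw [hyx]
      exact lt_of_le_of_ne (χ.nonneg i _) hi.symm
    exact mul_pos h1 hy
  · obtain ⟨I, hI⟩ := LocallyFinite.exists_finset_support χ.locallyFinite (q x₀)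
    obtain ⟨K₀, hK₀, hxK₀⟩ := exists_compact_mem_nhds x₀
    -- Near the orbit of `x₀` only the finitely many indices in `I` contribute. This confines
    -- sources to a compact set and ranges to `K₀`, so properness makes the set of arrows compact.
    refine ⟨(fun g : Arr X => (g.src, g.tgt)) ⁻¹' ((⋃ i ∈ I, tsupport (f i)) ×ˢ K₀),
      hproper.isCompact_preimage ((I.isCompact_biUnion fun i _ => hfc i).prod hK₀), ?_⟩
    filter_upwards [hxK₀, hq.continuousAt.eventually hI] with x hx hxI γ hγ
    obtain ⟨i, hi⟩ : ∃ i, χ i (q γ.1.src) * f i γ.1.src ≠ 0 := by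
      by_contra! h
      exact hγ (finsum_eq_zero_of_forall_eq_zero h)
    have hqγ : q γ.1.src = q x := orbitMk_eq_iff.2 ⟨γ.1, rfl, γ.2⟩
    rw [hqγ] at hi
    refine ⟨Set.mem_biUnion (hxI (left_ne_zero_of_mul hi))
      (subset_tsupport _ (right_ne_zero_of_mul hi)), ?_⟩
    exact Set.mem_of_eq_of_mem γ.2 hx

/-- A proper groupoid with a Haar system has a cutoff function. -/
theorem HaarSystem.exists_cutoff [NormalSpace (Arr X)] [ParacompactSpace (OrbitSpace X)]
    (hproper : IsProperGroupoid X) :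
    ∃ c : X → ℝ, Continuous c ∧ (∀ x, ∫ γ : RangeFibre x, c γ.1.src ∂(μ.μ x) = 1) ∧
      ∀ x₀, ∃ K : Set (Arr X), IsCompact K ∧
        ∀ᶠ x in 𝓝 x₀, ∀ γ : RangeFibre x, c γ.1.src ≠ 0 → γ.1 ∈ K := by
  obtain ⟨c, hc, hc0, hcne, hcK⟩ := μ.exists_precutoff hproper
  have hsrc := TopologicalGroupoid.continuous_src (X := X)
  have hcont : Continuous fun x : X => ∫ γ : RangeFibre x, c γ.1.src ∂(μ.μ x) := by
    refine continuous_iff_continuousAt.2 fun x₀ => ?_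
    obtain ⟨K, hK, h⟩ := hcK x₀
    exact μ.continuousAt_integral (b := id) (H := fun x γ => c γ.1.src) continuous_id
      (hc.comp (hsrc.comp (continuous_snd.comp continuous_subtype_val))) hK h
  have hinv : ∀ g : Arr X, ∫ γ : RangeFibre g.src, c γ.1.src ∂(μ.μ g.src) =
      ∫ γ : RangeFibre g.tgt, c γ.1.src ∂(μ.μ g.tgt) := fun g =>
    μ.integral_leftMul g.hom fun γ => c γ.1.src
  have hpos : ∀ x : X, 0 < ∫ γ : RangeFibre x, c γ.1.src ∂(μ.μ x) := by
    intro x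
    have := μ.fullSupport x
    have := μ.regular x
    obtain ⟨g, hg, hgc⟩ := hcne x
    obtain ⟨K, hK, h⟩ := hcK x
    exact Continuous.integral_pos_of_hasCompactSupport_nonneg_nonzero (x := ⟨g, hg⟩)
      (hc.comp (hsrc.comp continuous_subtype_val))
      (hasCompactSupport_rangeFibre hK h.self_of_nhds) (fun γ => hc0 _) hgc
  refine ⟨fun x => c x / ∫ γ : RangeFibre x, c γ.1.src ∂(μ.μ x),
    hc.div hcont fun x => (hpos x).ne', fun x => ?_, fun x₀ => ?_⟩
  -- The normalising integral is constant on orbits by left invariance, so it can be evaluated at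
  -- `x` and leaves the integral.
  · have : ∀ γ : RangeFibre x, c γ.1.src / ∫ h : RangeFibre γ.1.src, c h.1.src ∂(μ.μ γ.1.src) =
        c γ.1.src / ∫ h : RangeFibre x, c h.1.src ∂(μ.μ x) := by
      rintro ⟨g, rfl⟩
      rw [hinv g]
    simp only [this]
    rw [integral_div]
    exact div_self (hpos x).ne'
  · obtain ⟨K, hK, h⟩ := hcK x₀
    refine ⟨K, hK, h.mono fun x hx γ hγ => hx γ fun h0 => hγ ?_⟩
    simp only [h0, zero_div]

theorem HaarSystem.continuousAt_integral_euclidean [NormalSpace (Arr X)] {p : ℕ} {Y : Type*}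
    [TopologicalSpace Y] {b : Y → X} (hb : Continuous b)
    {H : ∀ y, RangeFibre (b y) → EuclideanSpace ℝ (Fin p)}
    (hH : Continuous fun q : FibreProd b => H q.1.1 ⟨q.1.2, q.2⟩) {y₀ : Y} {K : Set (Arr X)}
    (hK : IsCompact K) (hsupp : ∀ᶠ y in 𝓝 y₀, ∀ γ, H y γ ≠ 0 → γ.1 ∈ K) :
    ContinuousAt (fun y => ∫ γ, H y γ ∂(μ.μ (b y))) y₀ := by
  have hfib : ∀ y, Continuous (H y) := fun y =>
    hH.comp (f := fun γ : RangeFibre (b y) => (⟨(y, γ.1), γ.2⟩ : FibreProd b))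
      ((Continuous.prodMk continuous_const continuous_subtype_val).subtype_mk _)
  rw [← (PiLp.homeomorph 2 fun _ : Fin p => ℝ).comp_continuousAt_iff, continuousAt_pi]
  intro i
  have hev : ∀ᶠ y in 𝓝 y₀, ∫ γ, H y γ i ∂(μ.μ (b y)) = (∫ γ, H y γ ∂(μ.μ (b y))) i := by
    filter_upwards [hsupp] with y hy
    exact (EuclideanSpace.proj (𝕜 := ℝ) i).integral_comp_comm (μ.integrable (hfib y) hK hy)
  refine ContinuousAt.congr ?_ hev
  refine μ.continuousAt_integral (H := fun y γ => H y γ i) hb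
    ((EuclideanSpace.proj (𝕜 := ℝ) i).continuous.comp hH) hK
    (hsupp.mono fun y hy γ hγ => hy γ fun h => hγ (by simp [h]))

end Cutoff

/-! ## Product weights -/

section ProductWeights

open Function

variable {I I' : Type*} [Fintype I] [Fintype I'] {J : I → Type*}

theorem finite_support_prod {P : ∀ i, J i → ℝ} (hfin : ∀ i, (support (P i)).Finite) :
    (support fun a : ∀ i, J i => ∏ i, P i (a i)).Finite :=
  (Set.Finite.pi' hfin).subset fun _ ha i => Finset.prod_ne_zero_iff.1 ha i (Finset.mem_univ i)

/-- The marginals of a product of finitely supported weights are products. -/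
theorem finsum_prod_smul_comp {e : I' → I} (he : Injective e) {P : ∀ i, J i → ℝ}
    (hfin : ∀ i, (support (P i)).Finite) (hsum : ∀ i, i ∉ Set.range e → ∑ᶠ j, P i j = 1)
    {V : Type*} [AddCommGroup V] [Module ℝ V] (G : (∀ i', J (e i')) → V) :
    ∑ᶠ a : ∀ i, J i, (∏ i, P i (a i)) • G (fun i' => a (e i')) =
      ∑ᶠ b : ∀ i', J (e i'), (∏ i', P (e i') (b i')) • G b := by
  classical
  let S : ∀ i, Finset (J i) := fun i => (hfin i).toFinset
  have hS : ∀ i j, P i j ≠ 0 → j ∈ S i := fun i j h => (hfin i).mem_toFinset.2 h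
  rw [finsum_eq_sum_of_support_subset (s := Fintype.piFinset S) _ (fun a ha => ?_),
    finsum_eq_sum_of_support_subset (s := Fintype.piFinset fun i' => S (e i')) _ (fun b hb => ?_),
    ← Finset.sum_fiberwise_of_maps_to (s := Fintype.piFinset S)
      (t := Fintype.piFinset fun i' => S (e i')) (g := fun a i' => a (e i'))]
  · refine Finset.sum_congr rfl fun b hb => ?_
    rw [Fintype.mem_piFinset] at hb
    have h1 : ∀ a ∈ (Fintype.piFinset S).filter (fun a => (fun i' => a (e i')) = b),
        (∏ i, P i (a i)) • G (fun i' => a (e i')) = (∏ i, P i (a i)) • G b := by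
      intro a ha
      rw [(Finset.mem_filter.1 ha).2]
    rw [Finset.sum_congr rfl h1, ← Finset.sum_smul]
    congr 1
    -- The families restricting to `b` form a product set: a singleton at each coordinate in the
    -- range of `e`, all of `S i` elsewhere. The sum of products thus factors, and the free
    -- coordinates contribute factors 1.
    let T : ∀ i, Finset (J i) := fun i => (S i).filter fun j => ∀ i' (h : e i' = i), h ▸ b i' = j
    have hT : (Fintype.piFinset S).filter (fun a => (fun i' => a (e i')) = b) =
        Fintype.piFinset T := by
      ext a
      simp only [Finset.mem_filter, Fintype.mem_piFinset, T]
      constructor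
      · rintro ⟨h, rfl⟩ i
        refine ⟨h i, ?_⟩
        rintro i' rfl
        rfl
      · intro h
        exact ⟨fun i => (h i).1, funext fun i' => ((h (e i')).2 i' rfl).symm⟩
    rw [hT, ← Finset.prod_univ_sum]
    refine (Fintype.prod_of_injective e he _ _ (fun i hi => ?_) fun i' => ?_).symm
    · rw [← hsum i hi, finsum_eq_sum_of_support_subset (s := S i) _ fun j hj => hS i j hj]
      refine Finset.sum_congr (Finset.filter_true_of_mem fun j _ i' h => ?_) fun _ _ => rfl
      exact absurd ⟨i', h⟩ hi
    · have : T (e i') = {b i'} := by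
        ext j
        simp only [T, Finset.mem_filter, Finset.mem_singleton]
        constructor
        · intro h
          exact (h.2 i' rfl).symm
        · rintro rfl
          refine ⟨hb i', fun i'' h => ?_⟩
          obtain rfl := he h
          rfl
      rw [this, Finset.sum_singleton]
  · intro a ha
    rw [Fintype.mem_piFinset] at ha ⊢
    exact fun i' => ha (e i')
  · rw [Finset.mem_coe, Fintype.mem_piFinset]
    exact fun i' => hS _ _ (Finset.prod_ne_zero_iff.1 (left_ne_zero_of_smul hb) i'
      (Finset.mem_univ i'))
  · rw [Finset.mem_coe, Fintype.mem_piFinset]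
    exact fun i => hS _ _ (Finset.prod_ne_zero_iff.1 (left_ne_zero_of_smul ha) i
      (Finset.mem_univ i))

theorem locallyFinite_support_prod {Y : Type*} [TopologicalSpace Y] {P : ∀ i, J i → Y → ℝ}
    (hP : ∀ i, LocallyFinite fun j => support (P i j)) :
    LocallyFinite fun a : ∀ i, J i => support fun y => ∏ i, P i (a i) y := by
  intro y
  choose N hN hfin using fun i => hP i y
  refine ⟨⋂ i, N i, Filter.iInter_mem.2 hN, (Set.Finite.pi' hfin).subset ?_⟩
  rintro a ⟨z, hz, hzN⟩ i
  exact ⟨z, Finset.prod_ne_zero_iff.1 hz i (Finset.mem_univ i), Set.mem_iInter.1 hzN i⟩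

end ProductWeights

/-! ## Weights on the index sets `Λ_n` -/

section LamWeights

open Function

/-- The set of all faces of the simplex `[n]`. -/
abbrev FaceIndex (n : ℕ) : Type := Σ k : ℕ, Fin (k + 1) ↪o Fin (n + 1)

instance (n : ℕ) : Finite (FaceIndex n) := by
  refine Finite.of_surjective
    (fun q : Σ k : Fin (n + 1), Fin (k.1 + 1) ↪o Fin (n + 1) => (⟨q.1.1, q.2⟩ : FaceIndex n)) ?_
  rintro ⟨k, f⟩
  have := Fintype.card_le_of_injective f f.injective
  simp only [Fintype.card_fin] at this
  exact ⟨⟨⟨k, by omega⟩, f⟩, rfl⟩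

instance (n : ℕ) : Fintype (FaceIndex n) := Fintype.ofFinite _

/-- Gives the dichotomy behind `extWeight`: a face of `[n + 1]` either contains the last vertex or
is already a face of `[n]`. -/
theorem exists_trans_eq_of_last_notMem {n k : ℕ} {f : Fin (k + 1) ↪o Fin (n + 2)}
    (h : Fin.last (n + 1) ∉ Set.range f) :
    ∃ g : Fin (k + 1) ↪o Fin (n + 1), g.trans (Fin.succAboveOrderEmb (Fin.last (n + 1))) = f := by
  have h' : ∀ i, f i ≠ Fin.last (n + 1) := fun i hi => h ⟨i, hi⟩
  refine ⟨OrderEmbedding.ofStrictMono (fun i => (f i).castPred (h' i)) fun i j hij => ?_, ?_⟩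
  · exact Fin.castPred_lt_castPred (f.strictMono hij) _
  · ext i
    change ((Fin.last (n + 1)).succAbove ((f i).castPred (h' i))).val = _
    simp

theorem trans_right_injective {k m n : ℕ} (e : Fin (m + 1) ↪o Fin (n + 1)) :
    Injective fun g : Fin (k + 1) ↪o Fin (m + 1) => g.trans e := by
  intro g h hgh
  ext i
  exact congrArg Fin.val (e.injective (DFunLike.congr_fun hgh i))

variable {X : Type u} [Groupoid.{v} X] [TopologicalSpace (Arr X)] {𝒰 : OpenCover X}

/-- The face of an index in `Λ_n`. -/
abbrev lamFace {m n : ℕ} (e : Fin (m + 1) ↪o Fin (n + 1)) (l : 𝒰.Lam n) : 𝒰.Lam m :=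
  fun k g => l k (g.trans e)

/-- The product weight of a family of indices. -/
def lamWeight {n : ℕ} (P : ∀ k, (Fin (k + 1) ↪o Fin (n + 1)) → 𝒰.J k → ℝ) (l : 𝒰.Lam n) : ℝ :=
  ∏ i : FaceIndex n, P i.1 i.2 (l i.1 i.2)

theorem ne_zero_of_lamWeight_ne_zero {n : ℕ}
    {P : ∀ k, (Fin (k + 1) ↪o Fin (n + 1)) → 𝒰.J k → ℝ} {l : 𝒰.Lam n} (h : lamWeight P l ≠ 0)
    (k : ℕ) (f : Fin (k + 1) ↪o Fin (n + 1)) : P k f (l k f) ≠ 0 :=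
  Finset.prod_ne_zero_iff.1 h ⟨k, f⟩ (Finset.mem_univ _)

theorem finite_support_lamWeight {n : ℕ} {P : ∀ k, (Fin (k + 1) ↪o Fin (n + 1)) → 𝒰.J k → ℝ}
    (hfin : ∀ k f, (support (P k f)).Finite) : (support (lamWeight P)).Finite :=
  (finite_support_prod (I := FaceIndex n) (P := fun i => P i.1 i.2) fun i => hfin i.1 i.2).preimage
    (f := (Equiv.piCurry fun k (_ : Fin (k + 1) ↪o Fin (n + 1)) => 𝒰.J k).symm)
    (Equiv.injective _).injOn

/-- Averaging a function of the face of an index is averaging over `Λ_m` with the marginal weights: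
the coordinates at faces not factoring through `e` sum out to 1. -/
theorem finsum_lamWeight_face {m n : ℕ} (e : Fin (m + 1) ↪o Fin (n + 1))
    {P : ∀ k, (Fin (k + 1) ↪o Fin (n + 1)) → 𝒰.J k → ℝ}
    (hfin : ∀ k f, (support (P k f)).Finite) (hsum : ∀ k f, ∑ᶠ j, P k f j = 1)
    {V : Type*} [AddCommGroup V] [Module ℝ V] (G : 𝒰.Lam m → V) :
    ∑ᶠ l : 𝒰.Lam n, lamWeight P l • G (lamFace e l) =
      ∑ᶠ l : 𝒰.Lam m, lamWeight (fun k g => P k (g.trans e)) l • G l := by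
  have he : Injective fun i : FaceIndex m => (⟨i.1, i.2.trans e⟩ : FaceIndex n) := by
    rintro ⟨k, g⟩ ⟨k', g'⟩ h
    obtain ⟨rfl, h⟩ := Sigma.mk.inj_iff.1 h
    exact congrArg (Sigma.mk k) (trans_right_injective e (eq_of_heq h))
  have h := finsum_prod_smul_comp he (J := fun i => 𝒰.J i.1) (P := fun i => P i.1 i.2)
    (fun i => hfin i.1 i.2) (fun i _ => hsum i.1 i.2) (fun b => G fun k g => b ⟨k, g⟩)
  rw [← finsum_comp_equiv (Equiv.piCurry fun k (_ : Fin (k + 1) ↪o Fin (n + 1)) => 𝒰.J k),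
    ← finsum_comp_equiv (Equiv.piCurry fun k (_ : Fin (k + 1) ↪o Fin (m + 1)) => 𝒰.J k)]
  exact h

theorem finsum_lamWeight_smul_const {n : ℕ}
    {P : ∀ k, (Fin (k + 1) ↪o Fin (n + 1)) → 𝒰.J k → ℝ}
    (hfin : ∀ k f, (support (P k f)).Finite) (hsum : ∀ k f, ∑ᶠ j, P k f j = 1)
    {V : Type*} [AddCommGroup V] [Module ℝ V] (v : V) :
    ∑ᶠ l : 𝒰.Lam n, lamWeight P l • v = v := by
  -- The marginal on no coordinates at all is the total mass.
  have h := finsum_prod_smul_comp (e := fun i : Empty => (i.elim : FaceIndex n))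
    (fun i => i.elim) (J := fun i => 𝒰.J i.1) (P := fun i => P i.1 i.2)
    (fun i => hfin i.1 i.2) (fun i _ => hsum i.1 i.2) (fun _ => v)
  rw [← finsum_comp_equiv (Equiv.piCurry fun k (_ : Fin (k + 1) ↪o Fin (n + 1)) => 𝒰.J k)]
  refine Eq.trans h ?_
  rw [finsum_unique]
  simp

theorem locallyFinite_support_lamWeight {n : ℕ} {Y : Type*} [TopologicalSpace Y]
    {P : Y → ∀ k, (Fin (k + 1) ↪o Fin (n + 1)) → 𝒰.J k → ℝ}
    (hP : ∀ k f, LocallyFinite fun j => support fun y => P y k f j) :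
    LocallyFinite fun l : 𝒰.Lam n => support fun y => lamWeight (P y) l :=
  (locallyFinite_support_prod (I := FaceIndex n) (P := fun i j y => P y i.1 i.2 j)
    fun i => hP i.1 i.2).comp_injective
    (Equiv.piCurry fun k (_ : Fin (k + 1) ↪o Fin (n + 1)) => 𝒰.J k).symm.injective

theorem continuous_lamWeight {n : ℕ} {Y : Type*} [TopologicalSpace Y]
    {P : Y → ∀ k, (Fin (k + 1) ↪o Fin (n + 1)) → 𝒰.J k → ℝ}
    (hP : ∀ k f j, Continuous fun y => P y k f j) (l : 𝒰.Lam n) :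
    Continuous fun y => lamWeight (P y) l :=
  continuous_finsetProd _ fun i _ => hP i.1 i.2 _

/-! ### Extending an index in `Λ_n` to `Λ_{n+1}` -/

open scoped Classical in
/-- The weights for choosing an extension of `l ∈ Λ_n` to `Λ_{n+1}` at the point `ψ ∈ 𝒢_{n+1}`: the
components at the faces that contain the last vertex are chosen with a partition of unity, the
others are given by `l`. -/
def extWeight (χ : ∀ k, PartitionOfUnity (𝒰.J k) (Nerve X k)) {n : ℕ} (l : 𝒰.Lam n)
    (ψ : Nerve X (n + 1)) (k : ℕ) (f : Fin (k + 1) ↪o Fin (n + 2)) (j : 𝒰.J k) : ℝ :=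
  if Fin.last (n + 1) ∈ Set.range f then χ k j (Nerve.pull f ψ)
  -- Exactly one `g` factors such an `f`, so this is the point mass at `l k g`; quantifying over `g`
  -- avoids choosing it.
  else if ∀ g : Fin (k + 1) ↪o Fin (n + 1),
    g.trans (Fin.succAboveOrderEmb (Fin.last (n + 1))) = f → l k g = j then 1 else 0

variable (χ : ∀ k, PartitionOfUnity (𝒰.J k) (Nerve X k)) {n : ℕ} (l : 𝒰.Lam n)

theorem extWeight_of_mem {k : ℕ} {f : Fin (k + 1) ↪o Fin (n + 2)}
    (h : Fin.last (n + 1) ∈ Set.range f) (ψ : Nerve X (n + 1)) (j : 𝒰.J k) :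
    extWeight χ l ψ k f j = χ k j (Nerve.pull f ψ) :=
  if_pos h

theorem last_notMem_range_trans {k : ℕ} (g : Fin (k + 1) ↪o Fin (n + 1)) :
    Fin.last (n + 1) ∉ Set.range (g.trans (Fin.succAboveOrderEmb (Fin.last (n + 1)))) := by
  rintro ⟨i, hi⟩
  exact Fin.succAbove_ne _ _ hi

open scoped Classical in
theorem extWeight_trans {k : ℕ} (g : Fin (k + 1) ↪o Fin (n + 1)) (ψ : Nerve X (n + 1))
    (j : 𝒰.J k) :
    extWeight χ l ψ k (g.trans (Fin.succAboveOrderEmb (Fin.last (n + 1)))) j =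
      if l k g = j then 1 else 0 := by
  rw [extWeight, if_neg (last_notMem_range_trans g)]
  congr 1
  refine propext ⟨fun h => h g rfl, fun h g' hg' => ?_⟩
  rwa [trans_right_injective _ hg']

theorem finite_support_extWeight (ψ : Nerve X (n + 1)) (k : ℕ) (f : Fin (k + 1) ↪o Fin (n + 2)) :
    (support (extWeight χ l ψ k f)).Finite := by
  by_cases h : Fin.last (n + 1) ∈ Set.range f
  · refine ((χ k).locallyFinite.point_finite (Nerve.pull f ψ)).subset fun j hj => ?_
    rwa [mem_support, extWeight_of_mem χ l h] at hj
  · obtain ⟨g, rfl⟩ := exists_trans_eq_of_last_notMem h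
    refine (Set.finite_singleton (l k g)).subset fun j hj => ?_
    rw [mem_support, extWeight_trans] at hj
    by_contra h'
    exact hj (if_neg fun h'' => h' h''.symm)

theorem finsum_extWeight (ψ : Nerve X (n + 1)) (k : ℕ) (f : Fin (k + 1) ↪o Fin (n + 2)) :
    ∑ᶠ j, extWeight χ l ψ k f j = 1 := by
  by_cases h : Fin.last (n + 1) ∈ Set.range f
  · simp only [extWeight_of_mem χ l h]
    exact (χ k).sum_eq_one (Set.mem_univ _)
  · obtain ⟨g, rfl⟩ := exists_trans_eq_of_last_notMem h
    simp only [extWeight_trans]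
    rw [finsum_eq_single _ (l k g) fun j hj => if_neg hj.symm, if_pos rfl]

theorem continuous_extWeight (k : ℕ) (f : Fin (k + 1) ↪o Fin (n + 2)) (j : 𝒰.J k) :
    Continuous fun ψ => extWeight χ l ψ k f j := by
  by_cases h : Fin.last (n + 1) ∈ Set.range f
  · simp only [extWeight_of_mem χ l h]
    exact (χ k j).continuous.comp (Nerve.continuous_pull f)
  · obtain ⟨g, rfl⟩ := exists_trans_eq_of_last_notMem h
    simp only [extWeight_trans]
    exact continuous_const

theorem locallyFinite_extWeight (k : ℕ) (f : Fin (k + 1) ↪o Fin (n + 2)) :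
    LocallyFinite fun j => support fun ψ => extWeight χ l ψ k f j := by
  by_cases h : Fin.last (n + 1) ∈ Set.range f
  · simp only [extWeight_of_mem χ l h]
    exact (χ k).locallyFinite.preimage_continuous (Nerve.continuous_pull f)
  · obtain ⟨g, rfl⟩ := exists_trans_eq_of_last_notMem h
    refine fun ψ => ⟨Set.univ, Filter.univ_mem, (Set.finite_singleton (l k g)).subset ?_⟩
    rintro j ⟨ψ', hj, -⟩
    rw [mem_support, extWeight_trans] at hj
    by_contra h'
    exact hj (if_neg fun h'' => h' h''.symm)

/-- The extension weights are compatible with the faces that keep the last vertex. -/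
theorem extWeight_face (l : 𝒰.Lam (n + 1)) (i : Fin (n + 2)) (ψ : Nerve X (n + 2)) (k : ℕ)
    (f : Fin (k + 1) ↪o Fin (n + 2)) (j : 𝒰.J k) :
    extWeight χ l ψ k (f.trans (Fin.succAboveOrderEmb i.castSucc)) j =
      extWeight χ (lamFace (Fin.succAboveOrderEmb i) l)
        (Nerve.pull (Fin.succAboveOrderEmb i.castSucc) ψ) k f j := by
  by_cases h : Fin.last (n + 1) ∈ Set.range f
  · have h' : Fin.last (n + 2) ∈ Set.range (f.trans (Fin.succAboveOrderEmb i.castSucc)) := by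
      obtain ⟨a, ha⟩ := h
      exact ⟨a, by simp [ha]⟩
    rw [extWeight_of_mem _ _ h, extWeight_of_mem _ _ h']
    rfl
  · obtain ⟨g, rfl⟩ := exists_trans_eq_of_last_notMem h
    -- The cosimplicial identity: adding a last vertex commutes with omitting an earlier one.
    have h' : (g.trans (Fin.succAboveOrderEmb (Fin.last (n + 1)))).trans
        (Fin.succAboveOrderEmb i.castSucc) =
        (g.trans (Fin.succAboveOrderEmb i)).trans (Fin.succAboveOrderEmb (Fin.last (n + 2))) := by
      ext a
      simp
    rw [h', extWeight_trans, extWeight_trans]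

/-- The support of the extension weights consists of extensions of `l`. -/
theorem face_last_eq_of_lamWeight_ne_zero {ψ : Nerve X (n + 1)} {l' : 𝒰.Lam (n + 1)}
    (h : lamWeight (extWeight χ l ψ) l' ≠ 0) :
    lamFace (Fin.succAboveOrderEmb (Fin.last (n + 1))) l' = l := by
  funext k g
  have := ne_zero_of_lamWeight_ne_zero h k
    (g.trans (Fin.succAboveOrderEmb (Fin.last (n + 1))))
  rw [extWeight_trans] at this
  by_contra h'
  exact this (if_neg fun h'' => h' h''.symm)

/-- At faces containing the last vertex, membership follows from subordination; at the others it is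
inherited from `l`, which `l'` extends. The closed support is needed so that a weighted section can
be extended continuously by zero. -/
theorem mem_of_mem_tsupport_lamWeight (hχ : ∀ k, (χ k).IsSubordinate (𝒰.U k))
    {ψ : Nerve X (n + 1)} {l' : 𝒰.Lam (n + 1)}
    (hψ : Nerve.pull (Fin.succAboveOrderEmb (Fin.last (n + 1))) ψ ∈ 𝒰.natural.U n l)
    (h : ψ ∈ tsupport fun ψ => lamWeight (extWeight χ l ψ) l') : ψ ∈ 𝒰.natural.U (n + 1) l' := by
  obtain ⟨ψ', hψ'⟩ : ∃ ψ', lamWeight (extWeight χ l ψ') l' ≠ 0 := by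
    by_contra! h'
    simp [h', tsupport] at h
  have hface := face_last_eq_of_lamWeight_ne_zero χ l hψ'
  intro k f
  by_cases hf : Fin.last (n + 1) ∈ Set.range f
  · have h1 : (support fun ψ => lamWeight (extWeight χ l ψ) l') ⊆
        Nerve.pull f ⁻¹' (tsupport (χ k (l' k f))) := by
      intro ψ hψ
      have := ne_zero_of_lamWeight_ne_zero hψ k f
      rw [extWeight_of_mem χ l hf] at this
      exact subset_tsupport _ this
    exact hχ k (l' k f) (closure_minimal h1
      ((isClosed_tsupport _).preimage (Nerve.continuous_pull f)) h)
  · obtain ⟨g, rfl⟩ := exists_trans_eq_of_last_notMem hf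
    have := hψ k g
    rw [← hface] at this
    exact this

end LamWeights

/-! ## Integrals and locally finite sums of sections -/

section Bundle

variable {X : Type u} [Groupoid.{v} X] [TopologicalSpace X] [TopologicalSpace (Arr X)]
  {F : Type*} [NormedAddCommGroup F] [NormedSpace ℝ F]
  {E : X → Type w} [∀ x, AddCommGroup (E x)] [∀ x, Module ℝ (E x)]
  [∀ x, TopologicalSpace (E x)] [TopologicalSpace (TotalSpace F E)]
  [FiberBundle F E]

/-- The action of an arrow as a linear equivalence. -/
def GroupoidRep.actEquiv (ρ : GroupoidRep F E) {x y : X} (g : x ⟶ y) : E x ≃ₗ[ℝ] E y :=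
  LinearEquiv.ofLinearMap (ρ.act g) (ρ.act (Groupoid.inv g))
    (LinearMap.ext fun e => by
      rw [LinearMap.comp_apply, ← ρ.act_comp, Groupoid.inv_comp, ρ.act_id, LinearMap.id_apply])
    (LinearMap.ext fun e => by
      rw [LinearMap.comp_apply, ← ρ.act_comp, Groupoid.comp_inv, ρ.act_id, LinearMap.id_apply])

/-- Values at propositionally equal points lie in different fibre types. They are compared after
being moved into a common fibre, and the arrows are compared in `Arr X`, so no casts appear. -/
theorem GroupoidRep.act_congr (ρ : GroupoidRep F E) {n : ℕ} (t : ∀ φ : Nerve X n, E φ.last)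
    {φ ψ : Nerve X n} (h : φ = ψ) {z : X} {a : φ.last ⟶ z} {b : ψ.last ⟶ z}
    (hab : Arr.mk a = Arr.mk b) : ρ.act a (t φ) = ρ.act b (t ψ) := by
  subst h
  have : a = b := by simpa using hab
  rw [this]

theorem GroupoidRep.continuous_act_section (ρ : GroupoidRep F E) {B : Type*} [TopologicalSpace B]
    {a : B → Arr X} (ha : Continuous a) {t : ∀ y, E (a y).src}
    (ht : Continuous fun y => TotalSpace.mk' F (a y).src (t y)) :
    Continuous fun y => TotalSpace.mk' F (a y).tgt (ρ.act (a y).hom (t y)) := by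
  have key : Continuous fun y =>
      TotalSpace.mk' F (E := (fun g : Arr X => g.src) *ᵖ E) (a y) (t y) := by
    rw [(inducing_pullbackTotalSpaceEmbedding F E (fun g : Arr X => g.src)).continuous_iff]
    exact ha.prodMk ht
  exact ρ.continuous_act.comp key

variable [VectorBundle ℝ F E]

variable (F E) in
/-- A linear identification of a fibre of the bundle with the model fibre. -/
def fibreEquiv (x : X) : E x ≃L[ℝ] F :=
  (trivializationAt F E x).continuousLinearEquivAt ℝ x
    (FiberBundle.mem_baseSet_trivializationAt F E x)

variable (F) in
/-- The integral of a function with values in a fibre of the bundle. -/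
def fibreIntegral {T : Type*} [MeasurableSpace T] (ν : Measure T) {x : X} (S : T → E x) : E x :=
  (fibreEquiv F E x).symm (∫ t, fibreEquiv F E x (S t) ∂ν)

section FiniteDimensional

variable [FiniteDimensional ℝ F] {T : Type*} [MeasurableSpace T] (ν : Measure T) {x : X}

theorem continuous_linearEquiv (e : E x ≃ₗ[ℝ] F) : Continuous e := by
  have h : Continuous ((fibreEquiv F E x).symm.toLinearEquiv.trans e) :=
    LinearMap.continuous_of_finiteDimensional
      ((fibreEquiv F E x).symm.toLinearEquiv.trans e).toLinearMap
  convert h.comp (fibreEquiv F E x).continuous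
  ext v
  simp

/-- The fibre integral does not depend on the chosen identification with `F`: two of them differ by
a linear automorphism of a finite-dimensional space, which is continuous and commutes with the
integral even without integrability. -/
theorem map_fibreIntegral (e : E x ≃ₗ[ℝ] F) (S : T → E x) :
    e (fibreIntegral F ν S) = ∫ t, e (S t) ∂ν := by
  have h := ((fibreEquiv F E x).symm.toLinearEquiv.trans
    e).toContinuousLinearEquiv.integral_comp_comm (μ := ν) (fun t => fibreEquiv F E x (S t))
  simpa [fibreIntegral] using h.symm

theorem map_fibreIntegral' {y : X} (e : E x ≃ₗ[ℝ] E y) (S : T → E x) :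
    e (fibreIntegral F ν S) = fibreIntegral F ν fun t => e (S t) := by
  apply (fibreEquiv F E y).injective
  have h1 := map_fibreIntegral ν (e.trans (fibreEquiv F E y).toLinearEquiv) S
  have h2 := map_fibreIntegral ν (fibreEquiv F E y).toLinearEquiv (fun t => e (S t))
  exact h1.trans h2.symm

theorem fibreIntegral_sum_zsmul {ι : Type*} (s : Finset ι) (a : ι → ℤ) {S : ι → T → E x}
    (hS : ∀ i ∈ s, Integrable (fun t => fibreEquiv F E x (S i t)) ν) :
    ∑ i ∈ s, a i • fibreIntegral F ν (S i) = fibreIntegral F ν fun t => ∑ i ∈ s, a i • S i t := by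
  apply (fibreEquiv F E x).injective
  simp only [map_sum, map_zsmul]
  refine Eq.trans ?_ (map_fibreIntegral ν (fibreEquiv F E x).toLinearEquiv _).symm
  simp only [ContinuousLinearEquiv.coe_toLinearEquiv, map_sum, map_zsmul]
  rw [integral_finsetSum]
  · refine Finset.sum_congr rfl fun i _ => ?_
    have h := map_fibreIntegral ν (fibreEquiv F E x).toLinearEquiv (S i)
    simp only [ContinuousLinearEquiv.coe_toLinearEquiv] at h
    rw [h]
    simp only [← Int.cast_smul_eq_zsmul ℝ]
    rw [integral_smul]
  · intro i hi
    simp only [← Int.cast_smul_eq_zsmul ℝ]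
    exact (hS i hi).smul _

theorem fibreIntegral_smul_const {f : T → ℝ} (hf : ∫ t, f t ∂ν = 1) (v : E x) :
    fibreIntegral F ν (fun t => f t • v) = v := by
  apply (fibreEquiv F E x).injective
  refine (map_fibreIntegral ν (fibreEquiv F E x).toLinearEquiv _).trans ?_
  simp only [map_smul]
  rw [integral_smul_const, hf, one_smul]
  rfl

end FiniteDimensional

variable [TopologicalGroupoid X]

open scoped Classical in
/-- The extension by zero of a section. -/
def zeroExt {n : ℕ} {A : Set (Nerve X n)} (s : sections F E A) (φ : Nerve X n) : E φ.last :=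
  if h : φ ∈ A then s.1 ⟨φ, h⟩ else 0

theorem zeroExt_of_mem {n : ℕ} {A : Set (Nerve X n)} (s : sections F E A) {φ : Nerve X n}
    (h : φ ∈ A) : zeroExt s φ = s.1 ⟨φ, h⟩ :=
  dif_pos h

theorem continuousAt_trivialization_zeroExt {n : ℕ} {A : Set (Nerve X n)} (hA : IsOpen A)
    (s : sections F E A) {x : X} {φ : Nerve X n} (hφ : φ ∈ A)
    (hx : φ.last ∈ (trivializationAt F E x).baseSet) :
    ContinuousAt (fun ψ : Nerve X n =>
      (trivializationAt F E x (TotalSpace.mk' F ψ.last (zeroExt s ψ))).2) φ := by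
  refine (hA.isOpenEmbedding_subtypeVal.continuousAt_iff (x := ⟨φ, hφ⟩)).1 ?_
  have h1 : (fun ψ : A => TotalSpace.mk' F ψ.1.last (zeroExt s ψ.1)) =
      fun ψ : A => TotalSpace.mk' F ψ.1.last (s.1 ψ) :=
    funext fun ψ => by rw [zeroExt_of_mem s ψ.2]
  have h2 : Continuous fun ψ : A => TotalSpace.mk' F ψ.1.last (zeroExt s ψ.1) := by
    rw [h1]
    exact s.2
  exact ((trivializationAt F E x).continuousAt (by
    rwa [(trivializationAt F E x).mem_source])).comp h2.continuousAt |>.snd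

/-- Locally finite sums of sections are continuous. -/
theorem continuous_finsum_section {n : ℕ} {A : Set (Nerve X n)} {ι : Type*}
    {w : ι → Nerve X n → ℝ} (hw : ∀ i, Continuous (w i))
    (hlf : LocallyFinite fun i => Function.support (w i)) {U : ι → Set (Nerve X n)}
    (hU : ∀ i, IsOpen (U i)) (s : ∀ i, sections F E (U i))
    (h : ∀ i, ∀ φ ∈ A, φ ∈ tsupport (w i) → φ ∈ U i) :
    Continuous fun φ : A => TotalSpace.mk' F φ.1.last (∑ᶠ i, w i φ.1 • zeroExt (s i) φ.1) := by
  refine continuous_iff_continuousAt.2 fun φ₀ => (FiberBundle.continuousAt_totalSpace F _).2 ?_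
  have hlast : Continuous fun φ : Nerve X n => φ.last := Nerve.continuous_obj (Fin.last n)
  refine ⟨(hlast.comp continuous_subtype_val).continuousAt, ?_⟩
  set T := trivializationAt F E φ₀.1.last with hT
  have hbase : φ₀.1.last ∈ T.baseSet := FiberBundle.mem_baseSet_trivializationAt F E _
  obtain ⟨I, hI⟩ := LocallyFinite.exists_finset_support hlf φ₀.1
  have hev : ∀ᶠ φ : Nerve X n in 𝓝 φ₀.1,
      ∑ i ∈ I, w i φ • (T (TotalSpace.mk' F φ.last (zeroExt (s i) φ))).2 =
        (T (TotalSpace.mk' F φ.last (∑ᶠ i, w i φ • zeroExt (s i) φ))).2 := by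
    filter_upwards [hI, hlast.continuousAt.eventually (T.open_baseSet.mem_nhds hbase)] with φ h1 h2
    rw [finsum_eq_sum_of_support_subset (s := I) _ fun i hi => h1 (left_ne_zero_of_smul hi)]
    have h3 := map_sum (T.linearEquivAt ℝ φ.last h2) (fun i => w i φ • zeroExt (s i) φ) I
    simp only [map_smul] at h3
    exact h3.symm
  refine ContinuousAt.comp (f := Subtype.val) (x := φ₀) ?_ continuous_subtype_val.continuousAt
    (g := fun φ : Nerve X n => (T (TotalSpace.mk' F φ.last (∑ᶠ i, w i φ • zeroExt (s i) φ))).2)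
  refine ContinuousAt.congr ?_ hev
  refine tendsto_finsetSum _ fun i _ => ?_
  -- On the closed support of the weight, `φ₀` lies in the open set `U i` where the section is
  -- continuous; off it, the term vanishes near `φ₀`.
  by_cases hi : φ₀.1 ∈ tsupport (w i)
  · exact (hw i).continuousAt.smul
      (continuousAt_trivialization_zeroExt (hU i) (s i) (h i _ φ₀.2 hi) hbase)
  · have h0 : ∀ᶠ φ in 𝓝 φ₀.1, w i φ = 0 := notMem_tsupport_iff_eventuallyEq.1 hi
    have h1 : ContinuousAt (fun _ : Nerve X n => (0 : F)) φ₀.1 := continuousAt_const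
    refine h1.congr (h0.mono fun φ hφ => ?_)  |>.tendsto
    simp [hφ]

/-- Written with extensions by zero, the terms carry no membership proofs, so face indices can be
rewritten freely. -/
theorem differential_apply (ρ : GroupoidRep F E) (𝒰 : PreSimplicialCover X) (n : ℕ)
    (c : Cochain F E 𝒰.toOpenCover n) (j : 𝒰.J (n + 1)) (φ : 𝒰.U (n + 1) j) :
    (differential ρ 𝒰 n c j).1 φ = ∑ k : Fin (n + 2), ((-1 : ℤ) ^ (k : ℕ)) •
      ρ.act (φ.1.map (Fin.last (n + 1)) (Fin.succAboveOrderEmb k (Fin.last n)))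
        (zeroExt (c (𝒰.face (Fin.succAboveOrderEmb k) j))
          (Nerve.pull (Fin.succAboveOrderEmb k) φ.1)) := by
  simp only [differential, AddMonoidHom.pi_apply, AddMonoidHom.finsetSum_apply,
    AddMonoidHom.smul_apply, AddSubgroup.val_finsetSum, Finset.sum_apply]
  refine Finset.sum_congr rfl fun k _ => ?_
  rw [zeroExt_of_mem _ (𝒰.mapsTo (Fin.succAboveOrderEmb k) j φ.2)]
  rfl

end Bundle

/-! ## The arrows of an extended point of the nerve -/

section SnocArrow

variable {X : Type u} [Groupoid.{v} X]

/-- The family of arrows defining `φ.snoc γ`. -/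
abbrev Nerve.snocFan {n : ℕ} (φ : Nerve X n) (γ : RangeFibre φ.last) :
    Fin (n + 2) → RangeFibre φ.last :=
  Fin.snoc (α := fun _ => RangeFibre φ.last)
    (fun i => ⟨Arr.mk (φ.map (Fin.last n) i), rfl⟩) γ

/-- The arrow `γ`, as an arrow that starts at the last vertex of `φ.snoc γ`. -/
def Nerve.snocArrow {n : ℕ} (φ : Nerve X n) (γ : RangeFibre φ.last) :
    (φ.snoc γ).last ⟶ φ.last :=
  (φ.snocFan γ (Fin.last (n + 1))).1.hom ≫ eqToHom (φ.snocFan γ (Fin.last (n + 1))).2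

theorem RangeFibre.mk_comp_eqToHom {z : X} (γ : RangeFibre z) :
    Arr.mk (γ.1.hom ≫ eqToHom γ.2) = γ.1 := by
  obtain ⟨γ, rfl⟩ := γ
  simp

theorem comp_inv_comp_eqToHom {x x' y y' z : X} (a : x ⟶ y) (b : x' ⟶ y') (e : y = z)
    (e' : y' = z) :
    (a ≫ eqToHom (e.trans e'.symm) ≫ Groupoid.inv b) ≫ b ≫ eqToHom e' = a ≫ eqToHom e := by
  subst e
  subst e'
  simp

theorem mk_leftMul_comp {y z : X} {g : y ⟶ z} {g' : z ⟶ y} (h : g ≫ g' = 𝟙 y)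
    (γ : RangeFibre y) : Arr.mk ((leftMul g γ).1.hom ≫ eqToHom (leftMul g γ).2 ≫ g') = γ.1 := by
  obtain ⟨γ, rfl⟩ := γ
  simp [leftMul, h]

theorem Nerve.mk_snocArrow {n : ℕ} (φ : Nerve X n) (γ : RangeFibre φ.last) :
    Arr.mk (φ.snocArrow γ) = γ.1 :=
  (RangeFibre.mk_comp_eqToHom (φ.snocFan γ (Fin.last (n + 1)))).trans
    (congrArg Subtype.val (Fin.snoc_last (α := fun _ => RangeFibre φ.last) _ _))

/-- With fan arrows `bᵢ` and last one `γ`, this is `γ (γ⁻¹ bᵢ) = bᵢ`. Vertex `n` then gives a unit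
and the new vertex gives `γ`. -/
theorem Nerve.mk_map_comp_snocArrow {n : ℕ} (φ : Nerve X n) (γ : RangeFibre φ.last)
    (i : Fin (n + 2)) :
    Arr.mk ((φ.snoc γ).map (Fin.last (n + 1)) i ≫ φ.snocArrow γ) = (φ.snocFan γ i).1 :=
  (congrArg Arr.mk (comp_inv_comp_eqToHom _ _ (φ.snocFan γ i).2 (φ.snocFan γ _).2)).trans
    (RangeFibre.mk_comp_eqToHom (φ.snocFan γ i))

theorem Nerve.mk_map_castSucc_comp_snocArrow {n : ℕ} (φ : Nerve X n) (γ : RangeFibre φ.last) :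
    Arr.mk ((φ.snoc γ).map (Fin.last (n + 1))
      (Fin.succAboveOrderEmb (Fin.last (n + 1)) (Fin.last n)) ≫ φ.snocArrow γ) =
      Arr.mk (𝟙 φ.last) := by
  rw [Nerve.mk_map_comp_snocArrow]
  simp [Nerve.snocFan, φ.map_id]

theorem Nerve.mk_map_succAbove_comp_snocArrow {n : ℕ} (φ : Nerve X (n + 1))
    (γ : RangeFibre φ.last) (k : Fin (n + 2)) :
    Arr.mk ((φ.snoc γ).map (Fin.last (n + 2))
      (Fin.succAboveOrderEmb k.castSucc (Fin.last (n + 1))) ≫ φ.snocArrow γ) = γ.1 := by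
  rw [Nerve.mk_map_comp_snocArrow]
  simp [Nerve.snocFan]

theorem Nerve.mk_snocArrow_leftMul_comp {n : ℕ} (φ : Nerve X (n + 1)) (γ : RangeFibre φ.last)
    (k : Fin (n + 2)) :
    Arr.mk ((Nerve.pull k.succAbove φ).snocArrow
        (leftMul (φ.map (k.succAbove (Fin.last n)) (Fin.last (n + 1))) γ) ≫
      φ.map (Fin.last (n + 1)) (k.succAbove (Fin.last n))) = γ.1 := by
  have key : ∀ {a b c : X} (f : a ⟶ b) (g : b ⟶ c) (h : Arr X), Arr.mk f = h →
      ∀ e : h.tgt = b, Arr.mk (f ≫ g) = Arr.mk (h.hom ≫ eqToHom e ≫ g) := by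
    rintro a b c f g h rfl e
    simp
  exact (key _ _ _ (Nerve.mk_snocArrow _ _) rfl).trans
    (mk_leftMul_comp ((φ.map_comp _ _ _).trans (φ.map_id _)) γ)

end SnocArrow

/-! ## The contracting homotopy -/

section Homotopy

variable {X : Type u} [Groupoid.{v} X] [TopologicalSpace X] [TopologicalSpace (Arr X)]
  [TopologicalGroupoid X]
  {F : Type*} [NormedAddCommGroup F] [NormedSpace ℝ F]
  {E : X → Type w} [∀ x, AddCommGroup (E x)] [∀ x, Module ℝ (E x)]
  [∀ x, TopologicalSpace (E x)] [TopologicalSpace (TotalSpace F E)]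
  [FiberBundle F E] [VectorBundle ℝ F E] {𝒰 : OpenCover X}

/-- The mean of the components of a cochain over all extensions of the index `l`. -/
def extSection (χ : ∀ k, PartitionOfUnity (𝒰.J k) (Nerve X k)) {n : ℕ}
    (c : Cochain F E 𝒰.natural.toOpenCover (n + 1)) (l : 𝒰.Lam n) (ψ : Nerve X (n + 1)) :
    E ψ.last :=
  ∑ᶠ l' : 𝒰.Lam (n + 1), lamWeight (extWeight χ l ψ) l' • zeroExt (c l') ψ

theorem continuous_extSection {χ : ∀ k, PartitionOfUnity (𝒰.J k) (Nerve X k)}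
    (hχ : ∀ k, (χ k).IsSubordinate (𝒰.U k)) {n : ℕ}
    (c : Cochain F E 𝒰.natural.toOpenCover (n + 1)) (l : 𝒰.Lam n) :
    Continuous fun ψ : (Nerve.pull (Fin.succAboveOrderEmb (Fin.last (n + 1))) ⁻¹'
      𝒰.natural.U n l : Set (Nerve X (n + 1))) =>
        TotalSpace.mk' F ψ.1.last (extSection χ c l ψ.1) :=
  continuous_finsum_section (fun l' => continuous_lamWeight (continuous_extWeight χ l) l')
    (locallyFinite_support_lamWeight (locallyFinite_extWeight χ l))
    (fun l' => 𝒰.natural.isOpen_U (n + 1) l') c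
    fun _ _ hψ h => mem_of_mem_tsupport_lamWeight χ l hχ hψ h

variable (ρ : GroupoidRep F E) (χ : ∀ k, PartitionOfUnity (𝒰.J k) (Nerve X k)) {n : ℕ}
  (c : Cochain F E 𝒰.natural.toOpenCover (n + 1)) (l : 𝒰.Lam n)

/-- The integrand of the homotopy. -/
def homotopyIntegrand (φ : Nerve X n) (γ : RangeFibre φ.last) : E φ.last :=
  ρ.act (φ.snocArrow γ) (extSection χ c l (φ.snoc γ))

theorem continuous_homotopyIntegrand (hχ : ∀ k, (χ k).IsSubordinate (𝒰.U k)) {B : Type*}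
    [TopologicalSpace B] {f : B → Nerve X n} (hf : Continuous f)
    (hfl : ∀ y, f y ∈ 𝒰.natural.U n l) {g : ∀ y, RangeFibre (f y).last}
    (hg : Continuous fun y => (g y).1) :
    Continuous fun y => TotalSpace.mk' F (f y).last (homotopyIntegrand ρ χ c l (f y) (g y)) := by
  have h1 : Continuous fun y => TotalSpace.mk' F ((f y).snoc (g y)).last
      (extSection χ c l ((f y).snoc (g y))) := by
    have hmem : ∀ y, (f y).snoc (g y) ∈
        Nerve.pull (Fin.succAboveOrderEmb (Fin.last (n + 1))) ⁻¹' 𝒰.natural.U n l := fun y => by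
      have h := (f y).pull_castSucc_snoc (g y)
      rw [← Fin.succAbove_last] at h
      exact Set.mem_preimage.2 (Set.mem_of_eq_of_mem h (hfl y))
    exact (continuous_extSection hχ c l).comp ((Nerve.continuous_snoc hf hg).subtype_mk hmem)
  exact ρ.continuous_act_section (a := fun y => Arr.mk ((f y).snocArrow (g y)))
    (hg.congr fun y => (Nerve.mk_snocArrow _ _).symm) h1

/-- After the substitution that moves the integral to the fibre over `φ.last`, the `k`-th term of
the differential of the homotopy is the mean of the `k`-th term of `dc` at `(φ, γ)`. The points
agree by `Nerve.pull_succAbove_snoc`, the arrows compose to `γ` on both sides, and the weights agree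
because extending an index commutes with taking its `k`-th face. -/
theorem homotopyIntegrand_face (l : 𝒰.Lam (n + 1)) (φ : Nerve X (n + 1)) (γ : RangeFibre φ.last)
    (c : Cochain F E 𝒰.natural.toOpenCover (n + 1)) (k : Fin (n + 2)) :
    ρ.act (φ.map (Fin.last (n + 1)) (k.succAbove (Fin.last n)))
      (homotopyIntegrand ρ χ c (lamFace (Fin.succAboveOrderEmb k) l) (Nerve.pull k.succAbove φ)
        (leftMul (φ.map (k.succAbove (Fin.last n)) (Fin.last (n + 1))) γ)) =
      ρ.act (φ.snocArrow γ) (∑ᶠ l' : 𝒰.Lam (n + 2), lamWeight (extWeight χ l (φ.snoc γ)) l' •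
        ρ.act ((φ.snoc γ).map (Fin.last (n + 2))
          (Fin.succAboveOrderEmb k.castSucc (Fin.last (n + 1))))
          (zeroExt (c (lamFace (Fin.succAboveOrderEmb k.castSucc) l'))
            (Nerve.pull (Fin.succAboveOrderEmb k.castSucc) (φ.snoc γ)))) := by
  refine ((ρ.act_comp _ _ _).symm.trans
    (ρ.act_congr (extSection χ c (lamFace (Fin.succAboveOrderEmb k) l))
      (φ.pull_succAbove_snoc γ k).symm (b := (φ.snoc γ).map (Fin.last (n + 2))
      (Fin.succAboveOrderEmb k.castSucc (Fin.last (n + 1))) ≫ φ.snocArrow γ)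
      ((φ.mk_snocArrow_leftMul_comp γ k).trans
        (φ.mk_map_succAbove_comp_snocArrow γ k).symm))).trans ?_
  refine (ρ.act_comp _ _ _).trans ?_
  congr 1
  have h1 := finsum_lamWeight_face (Fin.succAboveOrderEmb k.castSucc)
    (finite_support_extWeight χ l (φ.snoc γ)) (finsum_extWeight χ l (φ.snoc γ))
    (fun l' : 𝒰.Lam (n + 1) => ρ.act ((φ.snoc γ).map (Fin.last (n + 2))
          (Fin.succAboveOrderEmb k.castSucc (Fin.last (n + 1)))) (zeroExt (c l')
            (Nerve.pull (Fin.succAboveOrderEmb k.castSucc) (φ.snoc γ))))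
  have h2 : (fun j (g : Fin (j + 1) ↪o Fin (n + 2)) => extWeight χ l (φ.snoc γ) j
      (g.trans (Fin.succAboveOrderEmb k.castSucc))) =
      extWeight χ (lamFace (Fin.succAboveOrderEmb k) l)
        (Nerve.pull (Fin.succAboveOrderEmb k.castSucc) (φ.snoc γ)) := by
    funext j g a
    exact extWeight_face χ l k (φ.snoc γ) j g a
  rw [h2] at h1
  refine Eq.trans ?_ h1.symm
  have h3 := (ρ.act ((φ.snoc γ).map (Fin.last (n + 2))
    (Fin.succAboveOrderEmb k.castSucc (Fin.last (n + 1))))).toAddMonoidHom.map_finsum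
    (f := fun l' : 𝒰.Lam (n + 1) => lamWeight (extWeight χ (lamFace (Fin.succAboveOrderEmb k) l)
        (Nerve.pull (Fin.succAboveOrderEmb k.castSucc) (φ.snoc γ))) l' • zeroExt (c l')
          (Nerve.pull (Fin.succAboveOrderEmb k.castSucc) (φ.snoc γ)))
    ((finite_support_lamWeight (finite_support_extWeight χ (lamFace (Fin.succAboveOrderEmb k) l)
        (Nerve.pull (Fin.succAboveOrderEmb k.castSucc) (φ.snoc γ)))).subset
      fun l' hl' => left_ne_zero_of_smul hl')
  refine h3.trans (finsum_congr fun l' => ?_)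
  exact map_smul (ρ.act _) _ _

/-- For each extension `l'` of nonzero weight, `(φ, γ)` lies in the set of index `l'`, so the
cocycle identity holds there. It expresses the sum over all faces but the last through the last one,
whose index is `l` and whose point is `φ`. -/
theorem sum_homotopyIntegrand_face (hχ : ∀ k, (χ k).IsSubordinate (𝒰.U k)) (l : 𝒰.Lam (n + 1))
    {φ : Nerve X (n + 1)} (hφ : φ ∈ 𝒰.natural.U (n + 1) l) (γ : RangeFibre φ.last)
    {c : Cochain F E 𝒰.natural.toOpenCover (n + 1)}
    (hc : differential ρ 𝒰.natural (n + 1) c = 0) :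
    ∑ k : Fin (n + 2), ((-1 : ℤ) ^ (k : ℕ)) •
      ρ.act (φ.map (Fin.last (n + 1)) (k.succAbove (Fin.last n)))
        (homotopyIntegrand ρ χ c (lamFace (Fin.succAboveOrderEmb k) l) (Nerve.pull k.succAbove φ)
          (leftMul (φ.map (k.succAbove (Fin.last n)) (Fin.last (n + 1))) γ)) =
      ((-1 : ℤ) ^ (n + 1)) • (c l).1 ⟨φ, hφ⟩ := by
  simp only [homotopyIntegrand_face]
  set ψ := φ.snoc γ with hψ
  have hpull : Nerve.pull (Fin.succAboveOrderEmb (Fin.last (n + 2))) ψ = φ := by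
    have h := φ.pull_castSucc_snoc γ
    rwa [← Fin.succAbove_last] at h
  have hfin := finite_support_lamWeight (finite_support_extWeight χ l ψ)
  simp only [← map_zsmul]
  rw [← map_sum]
  have h1 : ∑ k : Fin (n + 2), ((-1 : ℤ) ^ (k : ℕ)) •
      ∑ᶠ l' : 𝒰.Lam (n + 2), lamWeight (extWeight χ l ψ) l' •
        ρ.act (ψ.map (Fin.last (n + 2)) (Fin.succAboveOrderEmb k.castSucc (Fin.last (n + 1))))
          (zeroExt (c (lamFace (Fin.succAboveOrderEmb k.castSucc) l'))
            (Nerve.pull (Fin.succAboveOrderEmb k.castSucc) ψ)) =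
      ∑ᶠ l' : 𝒰.Lam (n + 2), lamWeight (extWeight χ l ψ) l' •
        ((-1 : ℤ) ^ (n + 1)) • ρ.act (ψ.map (Fin.last (n + 2))
          (Fin.succAboveOrderEmb (Fin.last (n + 2)) (Fin.last (n + 1)))) (zeroExt (c l)
            (Nerve.pull (Fin.succAboveOrderEmb (Fin.last (n + 2))) ψ)) := by
    have hsub : ∀ f : 𝒰.Lam (n + 2) → E ψ.last, (Function.support fun l' =>
        lamWeight (extWeight χ l ψ) l' • f l') ⊆ hfin.toFinset := fun f l' hl' => by
      rw [Set.Finite.coe_toFinset]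
      exact left_ne_zero_of_smul hl'
    rw [finsum_eq_sum_of_support_subset _ (hsub _)]
    have h2 : ∀ k : Fin (n + 2), _ := fun k => finsum_eq_sum_of_support_subset _ (hsub fun l' =>
      ρ.act (ψ.map (Fin.last (n + 2)) (Fin.succAboveOrderEmb k.castSucc (Fin.last (n + 1))))
        (zeroExt (c (lamFace (Fin.succAboveOrderEmb k.castSucc) l'))
          (Nerve.pull (Fin.succAboveOrderEmb k.castSucc) ψ)))
    simp only [h2, Finset.smul_sum]
    rw [Finset.sum_comm]
    refine Finset.sum_congr rfl fun l' hl' => ?_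
    rw [Set.Finite.mem_toFinset] at hl'
    simp only [smul_comm _ (lamWeight (extWeight χ l ψ) l')]
    rw [← Finset.smul_sum]
    congr 1
    have hmem : ψ ∈ 𝒰.natural.U (n + 2) l' :=
      mem_of_mem_tsupport_lamWeight χ l hχ (Set.mem_of_eq_of_mem hpull hφ)
        (subset_tsupport (fun ψ => lamWeight (extWeight χ l ψ) l') hl')
    have h3 := differential_apply ρ 𝒰.natural (n + 1) c l' ⟨ψ, hmem⟩
    rw [hc, Fin.sum_univ_castSucc] at h3
    have h4 : 𝒰.natural.face (Fin.succAboveOrderEmb (Fin.last (n + 2))) l' = l :=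
      face_last_eq_of_lamWeight_ne_zero χ l hl'
    rw [h4] at h3
    have h5 := eq_neg_of_add_eq_zero_left h3.symm
    refine h5.trans ?_
    -- The last face has sign `(-1)^{n+2}`; moving it across the equation leaves `(-1)^{n+1}`.
    rw [Fin.val_last, pow_succ (-1 : ℤ) (n + 1), mul_neg_one, neg_smul, neg_neg]
  rw [h1, finsum_lamWeight_smul_const (finite_support_extWeight χ l ψ) (finsum_extWeight χ l ψ),
    map_zsmul, ← ρ.act_comp, ρ.act_congr (zeroExt (c l)) hpull
      (φ.mk_map_castSucc_comp_snocArrow γ), ρ.act_id, zeroExt_of_mem _ hφ]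

end Homotopy

/-! ### Vanishing of the cohomology of every open cover -/

section Vanishing

variable {X : Type u} [Groupoid.{v} X] [TopologicalSpace X] [TopologicalSpace (Arr X)]
  [TopologicalGroupoid X] [T2Space (Arr X)] [LocallyCompactSpace (Arr X)]
  [MeasurableSpace (Arr X)] [BorelSpace (Arr X)] (μ : HaarSystem X)
  {p : ℕ} {E : X → Type w} [∀ x, AddCommGroup (E x)] [∀ x, Module ℝ (E x)]
  [∀ x, TopologicalSpace (E x)] [TopologicalSpace (TotalSpace (EuclideanSpace ℝ (Fin p)) E)]
  [FiberBundle (EuclideanSpace ℝ (Fin p)) E] [VectorBundle ℝ (EuclideanSpace ℝ (Fin p)) E]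

theorem HaarSystem.integrable_leftMul {x y : X} (g : x ⟶ y)
    {S : RangeFibre y → EuclideanSpace ℝ (Fin p)}
    (hS : Integrable S (μ.μ y)) : Integrable (fun γ => S (leftMul g γ)) (μ.μ x) := by
  rw [← μ.left_invariant g] at hS
  exact (leftMulHomeomorph g).measurableEmbedding.integrable_map_iff.1 hS

theorem HaarSystem.fibreIntegral_leftMul {x y z : X} (g : x ⟶ y) (S : RangeFibre y → E z) :
    fibreIntegral (EuclideanSpace ℝ (Fin p)) (μ.μ y) S =
      fibreIntegral (EuclideanSpace ℝ (Fin p)) (μ.μ x) fun γ => S (leftMul g γ) := by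
  simp only [fibreIntegral]
  rw [← μ.integral_leftMul g]

/-- The integral of a continuous family of vectors along the range fibres is continuous. -/
theorem HaarSystem.continuous_fibreIntegral [NormalSpace (Arr X)] {B : Type*} [TopologicalSpace B]
    {b : B → X} (hb : Continuous b) {R : ∀ y, RangeFibre (b y) → E (b y)}
    (hR : Continuous fun q : FibreProd b =>
      TotalSpace.mk' (EuclideanSpace ℝ (Fin p)) (b q.1.1) (R q.1.1 ⟨q.1.2, q.2⟩))
    {f : X → ℝ} (hf : Continuous f) (hfc : ∀ x₀, ∃ K : Set (Arr X), IsCompact K ∧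
        ∀ᶠ x in 𝓝 x₀, ∀ γ : RangeFibre x, f γ.1.src ≠ 0 → γ.1 ∈ K) :
    Continuous fun y => TotalSpace.mk' (EuclideanSpace ℝ (Fin p)) (b y)
      (fibreIntegral (EuclideanSpace ℝ (Fin p)) (μ.μ (b y)) fun γ => f γ.1.src • R y γ) := by
  refine continuous_iff_continuousAt.2 fun y₀ =>
    (FiberBundle.continuousAt_totalSpace (EuclideanSpace ℝ (Fin p)) _).2 ⟨hb.continuousAt, ?_⟩
  set T := trivializationAt (EuclideanSpace ℝ (Fin p)) E (b y₀) with hT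
  let V : Set B := b ⁻¹' T.baseSet
  have hV : IsOpen V := T.open_baseSet.preimage hb
  have hy₀ : y₀ ∈ V := FiberBundle.mem_baseSet_trivializationAt (EuclideanSpace ℝ (Fin p)) E _
  refine (hV.isOpenEmbedding_subtypeVal.continuousAt_iff (x := ⟨y₀, hy₀⟩)).1 ?_
  -- Over the open set `V` the local trivialization commutes with the fibre integral, which becomes
  -- an integral with values in a fixed Euclidean space.
  have h1 : ((fun y => (T (TotalSpace.mk' (EuclideanSpace ℝ (Fin p)) (b y)
      (fibreIntegral (EuclideanSpace ℝ (Fin p)) (μ.μ (b y)) fun γ =>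
        f γ.1.src • R y γ))).2) ∘ Subtype.val) =
      fun y : V => ∫ γ : RangeFibre (b y.1), f γ.1.src •
        (T (TotalSpace.mk' (EuclideanSpace ℝ (Fin p)) (b y.1) (R y.1 γ))).2 ∂(μ.μ (b y.1)) := by
    funext y
    have h := map_fibreIntegral (μ.μ (b y.1)) (T.linearEquivAt ℝ (b y.1) y.2)
      fun γ => f γ.1.src • R y.1 γ
    simp only [map_smul] at h
    exact h
  rw [h1]
  obtain ⟨K, hK, hKe⟩ := hfc (b y₀)
  have hb' : Continuous fun y : V => b y.1 := hb.comp continuous_subtype_val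
  refine μ.continuousAt_integral_euclidean (b := fun y : V => b y.1)
    (H := fun y γ => f γ.1.src •
      (T (TotalSpace.mk' (EuclideanSpace ℝ (Fin p)) (b y.1) (R y.1 γ))).2) hb' ?_ hK ?_
  · refine ((hf.comp TopologicalGroupoid.continuous_src).comp
      (continuous_snd.comp continuous_subtype_val)).smul ?_
    have h2 : Continuous fun q : FibreProd fun y : V => b y.1 =>
        TotalSpace.mk' (EuclideanSpace ℝ (Fin p)) (b q.1.1.1) (R q.1.1.1 ⟨q.1.2, q.2⟩) :=
      hR.comp (f := fun q : FibreProd fun y : V => b y.1 =>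
        (⟨(q.1.1.1, q.1.2), q.2⟩ : FibreProd b))
        (((continuous_subtype_val.comp (continuous_fst.comp continuous_subtype_val)).prodMk
          (continuous_snd.comp continuous_subtype_val)).subtype_mk _)
    exact (T.continuousOn.comp_continuous h2 fun q => T.mem_source.2 q.1.1.2).snd
  · filter_upwards [hb'.continuousAt.eventually hKe] with y hy γ hγ
    exact hy γ (left_ne_zero_of_smul hγ)

variable {𝒰 : OpenCover X} (ρ : GroupoidRep (EuclideanSpace ℝ (Fin p)) E)

/-- A cover with subordinate partitions of unity has trivial cohomology in positive degrees. -/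
theorem HaarSystem.exists_differential_eq [NormalSpace (Arr X)]
    {χ : ∀ k, PartitionOfUnity (𝒰.J k) (Nerve X k)} (hχ : ∀ k, (χ k).IsSubordinate (𝒰.U k))
    {f : X → ℝ} (hf : Continuous f) (hf1 : ∀ x, ∫ γ : RangeFibre x, f γ.1.src ∂(μ.μ x) = 1)
    (hfc : ∀ x₀, ∃ K : Set (Arr X), IsCompact K ∧
        ∀ᶠ x in 𝓝 x₀, ∀ γ : RangeFibre x, f γ.1.src ≠ 0 → γ.1 ∈ K)
    {n : ℕ} {c : Cochain (EuclideanSpace ℝ (Fin p)) E 𝒰.natural.toOpenCover (n + 1)}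
    (hc : differential ρ 𝒰.natural (n + 1) c = 0) :
    ∃ b, differential ρ 𝒰.natural n b = ((-1 : ℤ) ^ (n + 1)) • c := by
  let b : Cochain (EuclideanSpace ℝ (Fin p)) E 𝒰.natural.toOpenCover n := fun l =>
    ⟨fun φ => fibreIntegral (EuclideanSpace ℝ (Fin p)) (μ.μ φ.1.last) fun γ =>
      f γ.1.src • homotopyIntegrand ρ χ c l φ.1 γ,
      μ.continuous_fibreIntegral
        ((Nerve.continuous_obj (Fin.last n)).comp continuous_subtype_val)
        (continuous_homotopyIntegrand ρ χ c l hχ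
          (f := fun q : FibreProd fun φ : 𝒰.natural.U n l => φ.1.last => q.1.1.1)
          (g := fun q => ⟨q.1.2, q.2⟩)
          (continuous_subtype_val.comp (continuous_fst.comp continuous_subtype_val))
          (fun q => q.1.1.2) (continuous_snd.comp continuous_subtype_val)) hf hfc⟩
  refine ⟨b, funext fun l => Subtype.ext (funext fun φ => ?_)⟩
  refine (differential_apply ρ 𝒰.natural n b l φ).trans ?_
  obtain ⟨φ, hφ⟩ := φ
  have hmem : ∀ k : Fin (n + 2), Nerve.pull k.succAbove φ ∈
      𝒰.natural.U n (lamFace (Fin.succAboveOrderEmb k) l) := fun k =>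
    𝒰.natural.mapsTo (Fin.succAboveOrderEmb k) l hφ
  let S : Fin (n + 2) → RangeFibre φ.last → E φ.last := fun k γ =>
    ρ.act (φ.map (Fin.last (n + 1)) (k.succAbove (Fin.last n)))
      (homotopyIntegrand ρ χ c (lamFace (Fin.succAboveOrderEmb k) l) (Nerve.pull k.succAbove φ)
        (leftMul (φ.map (k.succAbove (Fin.last n)) (Fin.last (n + 1))) γ))
  -- The action is linear and passes under the integral. Left translation preserves sources, hence
  -- the factor `f`, so left invariance brings all `n + 2` integrals to the fibre over `φ.last`.
  have hb : ∀ k : Fin (n + 2),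
      ρ.act (φ.map (Fin.last (n + 1)) (Fin.succAboveOrderEmb k (Fin.last n)))
        (zeroExt (b (lamFace (Fin.succAboveOrderEmb k) l))
          (Nerve.pull (Fin.succAboveOrderEmb k) φ)) =
      fibreIntegral (EuclideanSpace ℝ (Fin p)) (μ.μ φ.last) fun γ => f γ.1.src • S k γ := by
    intro k
    refine (congrArg (ρ.act _) (zeroExt_of_mem _ (hmem k))).trans ?_
    refine (map_fibreIntegral' _ (ρ.actEquiv _) _).trans ?_
    simp only [map_smul]
    exact μ.fibreIntegral_leftMul (φ.map (k.succAbove (Fin.last n)) (Fin.last (n + 1))) _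
  -- Needed to exchange the sum over `k` with the integral. Before translation the integrand is
  -- continuous, with support inside the compact set attached to the cutoff function.
  have hint : ∀ k : Fin (n + 2), Integrable
      (fun γ => fibreEquiv (EuclideanSpace ℝ (Fin p)) E φ.last (f γ.1.src • S k γ))
      (μ.μ φ.last) := by
    intro k
    obtain ⟨K, hK, hKe⟩ := hfc (Nerve.pull k.succAbove φ).last
    refine μ.integrable_leftMul (φ.map (k.succAbove (Fin.last n)) (Fin.last (n + 1)))
      (S := fun γ => fibreEquiv (EuclideanSpace ℝ (Fin p)) E φ.last (f γ.1.src •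
        ρ.act (φ.map (Fin.last (n + 1)) (k.succAbove (Fin.last n)))
          (homotopyIntegrand ρ χ c (lamFace (Fin.succAboveOrderEmb k) l)
            (Nerve.pull k.succAbove φ) γ)))
      (μ.integrable ?_ hK fun γ hγ => hKe.self_of_nhds γ fun h => hγ ?_)
    · simp only [map_smul]
      refine (hf.comp ((TopologicalGroupoid.continuous_src (X := X)).comp
        continuous_subtype_val)).smul ?_
      have h1 := continuous_homotopyIntegrand ρ χ c (lamFace (Fin.succAboveOrderEmb k) l) hχ
        (f := fun _ : RangeFibre (Nerve.pull k.succAbove φ).last => Nerve.pull k.succAbove φ)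
        (g := fun γ => γ) continuous_const (fun _ => hmem k) continuous_subtype_val
      exact (continuous_linearEquiv ((ρ.actEquiv _).trans
        (fibreEquiv (EuclideanSpace ℝ (Fin p)) E φ.last).toLinearEquiv)).comp
          ((FiberBundle.totalSpaceMk_isInducing (EuclideanSpace ℝ (Fin p)) E _).continuous_iff.2 h1)
    · rw [h, zero_smul, map_zero]
  refine (Finset.sum_congr rfl fun (k : Fin (n + 2)) _ =>
    congrArg (fun v => ((-1 : ℤ) ^ (k : ℕ)) • v) (hb k)).trans ?_
  rw [fibreIntegral_sum_zsmul _ _ _ fun k _ => hint k]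
  have hsum : ∀ γ : RangeFibre φ.last,
      ∑ k : Fin (n + 2), ((-1 : ℤ) ^ (k : ℕ)) • (f γ.1.src • S k γ) =
        f γ.1.src • ((-1 : ℤ) ^ (n + 1)) • (c l).1 ⟨φ, hφ⟩ := by
    intro γ
    rw [← sum_homotopyIntegrand_face ρ χ hχ l hφ γ hc, Finset.smul_sum]
    exact Finset.sum_congr rfl fun k _ => smul_comm _ _ _
  simp only [hsum]
  exact fibreIntegral_smul_const _ (hf1 φ.last) _

include μ in
/-- The cohomology of every open cover vanishes in positive degrees. -/
theorem HaarSystem.subsingleton_coverCohomology [∀ n : ℕ, ParacompactSpace (Nerve X n)]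
    [ParacompactSpace (OrbitSpace X)] (hproper : IsProperGroupoid X) (𝒰 : OpenCover X) (n : ℕ) :
    Subsingleton (CoverCohomology ρ 𝒰 (n + 1)) := by
  have := normalSpace_arr X
  have := fun k => Nerve.t2Space (X := X) k
  obtain ⟨f, hf, hf1, hfc⟩ := μ.exists_cutoff hproper
  choose χ hχ using fun k => PartitionOfUnity.exists_isSubordinate (s := Set.univ)
    isClosed_univ (𝒰.U k) (𝒰.isOpen_U k) fun φ _ => Set.mem_iUnion.2 (𝒰.covers k φ)
  have h : ∀ c : (differential ρ 𝒰.natural (n + 1)).ker,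
      c ∈ (coboundaries ρ 𝒰.natural (n + 1)).addSubgroupOf
        (differential ρ 𝒰.natural (n + 1)).ker := by
    rintro ⟨c, hc⟩
    obtain ⟨b, hb⟩ := μ.exists_differential_eq ρ hχ hf hf1 hfc hc
    -- The sign in `hb` squares to 1.
    refine AddSubgroup.mem_addSubgroupOf.2 ⟨((-1 : ℤ) ^ (n + 1)) • b, ?_⟩
    rw [map_zsmul, hb, smul_smul, ← mul_pow, neg_one_mul, neg_neg, one_pow, one_smul]
  refine ⟨fun a b => ?_⟩
  induction a using QuotientAddGroup.induction_on
  induction b using QuotientAddGroup.induction_on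
  exact QuotientAddGroup.eq.2 (h _)

end Vanishing

end GroupoidCech

end

/-! ### The direct limit: a quotient of a direct sum of trivial groups -/

theorem mainTheorem6 {X : Type u} [Groupoid.{v} X] [TopologicalSpace X] [TopologicalSpace (Arr X)]
    [TopologicalGroupoid X] [LocallyCompactSpace (Arr X)] [T2Space (Arr X)]
    [MeasurableSpace (Arr X)] [BorelSpace (Arr X)]
    [∀ n : ℕ, ParacompactSpace (Nerve X n)] [ParacompactSpace (OrbitSpace X)]
    (hproper : IsProperGroupoid X) (μ : HaarSystem X)
    (p : ℕ) (E : X → Type w) [∀ x, AddCommGroup (E x)] [∀ x, Module ℝ (E x)]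
    [∀ x, TopologicalSpace (E x)] [TopologicalSpace (TotalSpace (EuclideanSpace ℝ (Fin p)) E)]
    [FiberBundle (EuclideanSpace ℝ (Fin p)) E] [VectorBundle ℝ (EuclideanSpace ℝ (Fin p)) E]
    (ρ : GroupoidRep (EuclideanSpace ℝ (Fin p)) E) (n : ℕ) (hn : 1 ≤ n) :
    Subsingleton (CechCohomology ρ n) := by
  obtain ⟨n, rfl⟩ := Nat.exists_eq_add_of_le' hn
  have := fun 𝒰 : CechIndex X (n + 1) => μ.subsingleton_coverCohomology ρ hproper 𝒰.1 n
  have : Subsingleton (DirectSum (CechIndex X (n + 1))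
      fun 𝒰 => CoverCohomology ρ 𝒰.1 (n + 1)) :=
    ⟨fun a b => DFinsupp.ext fun 𝒰 => Subsingleton.elim _ _⟩
  exact Quotient.instSubsingletonQuotient _
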